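/- Let $M$ be a unital $C^*$-algebra which is a finite $AW^*$-algebra; that is, for every subset $S\subseteq M$ there is a projection $p\in M$ with $\{x\in M: sx=0 \text{ for all } s\in S\}=pM$, and every $u\in M$ with $u^*u=1$ satisfies $uu^*=1$. Let $\tau:M\to\mathbb{C}$ be a normal faithful quasitrace on $M$. This means the following. (i) $\tau(x^*x)=\tau(xx^*)\ge 0$ for all $x\in M$. (ii) $\tau(a+ib)=\tau(a)+i\tau(b)$ for all self-adjoint $a,b\in M$. (iii) $\tau$ is linear on every abelian $C^*$-subalgebra of $M$. (iv) There is a function $\tau_2:M_2(M)\to\mathbb{C}$ satisfying (i), (ii) and (iii) on the $C^*$-algebra $M_2(M)$ such that $\tau(x)=\tau_2(x\otimes e_{11})$ for all $x\in M$. (Faithful) $\tau(x^*x)=0$ implies $x=0$. (Normal) $\tau\big(\bigvee_{i\in I}p_i\big)=\sum_{i\in I}\tau(p_i)$ for every orthogonal set $(p_i)_{i\in I}$ of projections in $M$, where $\bigvee$ denotes the supremum in the partially ordered set of projections of $M$. Put $\|x\|_2=\tau(x^*x)^{1/2}$ and $d_\tau(x,y)=\|x-y\|_2^{2/3}$ for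 $x,y\in M$. Then $d_\tau$ is a metric on $M$, and the closed unit ball $\{x\in M:\|x\|\le 1\}$ of $M$ is complete in the metric $d_\tau$. -/

import Mathlib

namespace Quasitrace

section

open scoped ComplexOrder

/-- A `1`-quasitrace on a unital C⋆-algebra. In `nonneg`, the order on `ℂ` is the usual one:
`0 ≤ z` says that `z` is real and nonnegative. -/
structure IsOneQuasitrace {A : Type*} [CStarAlgebra A] (τ : A → ℂ) : Prop where
  nonneg : ∀ x : A, 0 ≤ τ (star x * x)
  star_mul_comm : ∀ x : A, τ (star x * x) = τ (x * star x)
  add_I_smul : ∀ a b : A, IsSelfAdjoint a → IsSelfAdjoint b →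
    τ (a + Complex.I • b) = τ a + Complex.I * τ b
  /-- `τ` is linear on every abelian C⋆-subalgebra (norm-closed, not necessarily unital). -/
  linear_on_abelian : ∀ B : NonUnitalStarSubalgebra ℂ A, IsClosed (B : Set A) →
    (∀ x ∈ B, ∀ y ∈ B, x * y = y * x) → IsLinearMap ℂ (fun x : B => τ (x : A))

end

/-- A quasitrace (that is, a `2`-quasitrace) on a unital C⋆-algebra `A`: a `1`-quasitrace that
extends to a `1`-quasitrace on the C⋆-algebra `M₂(A)`, in the sense that
`τ x = τ₂ (x ⊗ e₁₁)`. -/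
structure IsQuasitrace {A : Type*} [CStarAlgebra A] [PartialOrder A] [StarOrderedRing A]
    (τ : A → ℂ) : Prop extends IsOneQuasitrace τ where
  exists_two : ∃ τ₂ : CStarMatrix (Fin 2) (Fin 2) A → ℂ, IsOneQuasitrace τ₂ ∧
    ∀ x : A, τ x = τ₂ (CStarMatrix.ofMatrix (Matrix.single 0 0 x))

/-- A quasitrace is faithful if `τ (x⋆ x) = 0` only for `x = 0`. -/
def IsFaithful {A : Type*} [CStarAlgebra A] (τ : A → ℂ) : Prop :=
  ∀ x : A, τ (star x * x) = 0 → x = 0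

/-- Normality: `τ (⋁ pᵢ) = ∑ τ (pᵢ)` for every set of pairwise orthogonal projections, the
supremum being taken in the partially ordered set of projections of `A`. -/
def IsNormal {A : Type*} [CStarAlgebra A] [PartialOrder A] (τ : A → ℂ) : Prop :=
  ∀ (S : Set {p : A // IsStarProjection p}) (q : {p : A // IsStarProjection p}),
    S.Pairwise (fun p r => (p : A) * (r : A) = 0) → IsLUB S q →
      HasSum (fun p : S => τ ((p : {p : A // IsStarProjection p}) : A)) (τ (q : A))

/-- `A` is an AW⋆-algebra: the right annihilator of every subset of `A` is of the form `pA` for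
a projection `p`. -/
def IsAWStar (A : Type*) [CStarAlgebra A] : Prop :=
  ∀ S : Set A, ∃ p : A, IsStarProjection p ∧
    {x : A | ∀ s ∈ S, s * x = 0} = Set.range (fun y : A => p * y)

/-- `A` is finite: the unit is not Murray–von Neumann equivalent to a proper subprojection, that
is, every isometry in `A` is unitary. -/
def IsFiniteAlg (A : Type*) [CStarAlgebra A] : Prop :=
  ∀ u : A, star u * u = 1 → u * star u = 1

/-- `‖x‖₂ = τ (x⋆ x) ^ (1/2)`. -/
noncomputable def norm₂ {A : Type*} [CStarAlgebra A] (τ : A → ℂ) (x : A) : ℝ :=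
  Real.sqrt (τ (star x * x)).re

/-- `d_τ (x, y) = ‖x - y‖₂ ^ (2/3)`. -/
noncomputable def d {A : Type*} [CStarAlgebra A] (τ : A → ℂ) (x y : A) : ℝ :=
  norm₂ τ (x - y) ^ (2 / 3 : ℝ)

end Quasitrace

/-! A quasitrace is additive only on commuting elements, so two facts must replace linearity. The
first is monotonicity on positive elements (`IsOneQuasitrace.re_mono`). If `a ≤ b`, each unit slice
of `a` has the form `x⋆x` with `xx⋆` below a slice of `b` two levels lower. Adding slices gives `τ a
≤ τ b + 2 τ 1`, and applying this to `n a ≤ n b` removes the error. The second is subadditivity with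
weights `1 + r` and `1 + r⁻¹`, which is monotonicity in `M₂(M)` applied to a column. Combined with
the operator inequality for `(x + y)⋆(x + y)` with the same `r`, it bounds `‖x + y‖₂²` with squared
weights. The best choice of `r` gives exactly the triangle inequality for `‖·‖₂ ^ (2/3)`.

For completeness, the limit is built from its binary digits. By Egorov's theorem, which uses
annihilator projections and normality, a Cauchy sequence converges after right multiplication by a
projection `e` with `τ (1 - e)` small. These local limits are not glued together. They define,
through an annihilator, one projection that asymptotically separates the positive and negative parts
of `x n - 1/2` (`IsCauchy₂.exists_separating_projection`). That projection is the first digit of a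
sequence in `[0, 1]`, and the remainder is again a Cauchy sequence in `[0, 1]`. Iterating gives a
norm-convergent series of projections, whose sum is the limit. Real and imaginary parts reduce the
unit ball to this case, and `IsNull.norm_limit_le_one` keeps the limit in the ball. -/

namespace Quasitrace

open Filter Topology

/-! ### Monotonicity of 1-quasitraces. -/

section OneQuasitrace

open scoped ComplexOrder

variable {A : Type*} [CStarAlgebra A] {τ : A → ℂ}

/-- A `1`-quasitrace restricted to the C⋆-algebra generated by two commuting self-adjoint elements
is linear. -/
theorem IsOneQuasitrace.exists_linear (hτ : IsOneQuasitrace τ) {a b : A} (ha : IsSelfAdjoint a)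
    (hb : IsSelfAdjoint b) (hab : Commute a b) :
    τ (a + b) = τ a + τ b ∧ ∀ c : ℂ, τ (c • a) = c * τ a := by
  set s : Set A := {a, b} with hs
  have h1 : ∀ x ∈ s, ∀ y ∈ s, x * y = y * x := by
    rintro x (rfl | rfl) y (rfl | rfl)
    exacts [rfl, hab.eq, hab.eq.symm, rfl]
  have h2 : ∀ x ∈ s, ∀ y ∈ s, x * star y = star y * x := by
    intro x hx y hy
    have : star y = y := by
      rcases hy with rfl | rfl
      exacts [ha.star_eq, hb.star_eq]
    rw [this]; exact h1 x hx y hy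
  let B₀ := NonUnitalStarAlgebra.adjoin ℂ s
  have hB₀ : IsMulCommutative B₀ := NonUnitalStarAlgebra.isMulCommutative_adjoin ℂ h1 h2
  let B := B₀.topologicalClosure
  have hcomm : ∀ x ∈ B, ∀ y ∈ B, x * y = y * x := by
    let := B₀.nonUnitalCommRingTopologicalClosure (fun x y => hB₀.is_comm.comm x y)
    intro x hx y hy
    exact congrArg Subtype.val (mul_comm (⟨x, hx⟩ : B) ⟨y, hy⟩)
  have hlin := hτ.linear_on_abelian B (NonUnitalStarSubalgebra.isClosed_topologicalClosure _) hcomm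
  have hsB : s ⊆ B := (NonUnitalStarAlgebra.subset_adjoin ℂ s).trans
    (NonUnitalStarSubalgebra.le_topologicalClosure B₀)
  have haB : a ∈ B := hsB (by simp [hs])
  have hbB : b ∈ B := hsB (by simp [hs])
  exact ⟨hlin.map_add ⟨a, haB⟩ ⟨b, hbB⟩, fun c => hlin.map_smul c ⟨a, haB⟩⟩

theorem IsOneQuasitrace.re_add (hτ : IsOneQuasitrace τ) {a b : A} (ha : IsSelfAdjoint a)
    (hb : IsSelfAdjoint b) (hab : Commute a b) : (τ (a + b)).re = (τ a).re + (τ b).re := by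
  rw [(hτ.exists_linear ha hb hab).1, Complex.add_re]

theorem IsOneQuasitrace.re_smul (hτ : IsOneQuasitrace τ) {a : A} (ha : IsSelfAdjoint a) (r : ℝ) :
    (τ (r • a)).re = r * (τ a).re := by
  have := (hτ.exists_linear ha ha (Commute.refl a)).2 r
  rw [Complex.coe_smul] at this
  rw [this, Complex.re_ofReal_mul]

theorem IsOneQuasitrace.map_zero (hτ : IsOneQuasitrace τ) : τ 0 = 0 := by
  simpa using (hτ.exists_linear (.zero A) (.zero A) (Commute.refl (0 : A))).2 0

theorem IsOneQuasitrace.re_star_mul_self_nonneg (hτ : IsOneQuasitrace τ) (x : A) :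
    0 ≤ (τ (star x * x)).re := (Complex.le_def.1 (hτ.nonneg x)).1

theorem cfc_conjugate_self {D : A} (hD : IsSelfAdjoint D) {φ : ℝ → ℝ} (hφ : Continuous φ) :
    cfc φ D * D * cfc φ D = cfc (fun s => φ s * s * φ s) D := by
  have h1 : cfc φ D * D = cfc (fun s => φ s * s) D := by
    rw [cfc_mul φ (fun s => s) D hφ.continuousOn continuous_id.continuousOn, cfc_id' ℝ D]
  rw [h1, ← cfc_mul (fun s => φ s * s) φ D (hφ.mul continuous_id).continuousOn hφ.continuousOn]

theorem star_cfc_real (φ : ℝ → ℝ) (D : A) : star (cfc φ D) = cfc φ D :=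
  (cfc_predicate φ D : IsSelfAdjoint _).star_eq

/-- The unit slices `s ↦ min (max (s - k) 0) 1`, which add up to the identity on `[0, ∞)`. -/
noncomputable def unitSlice (k : ℕ) (s : ℝ) : ℝ := min (max (s - k) 0) 1

theorem continuous_unitSlice (k : ℕ) : Continuous (unitSlice k) := by
  unfold unitSlice; fun_prop

theorem unitSlice_nonneg (k : ℕ) (s : ℝ) : 0 ≤ unitSlice k s := by
  simp [unitSlice]

theorem unitSlice_le_one (k : ℕ) (s : ℝ) : unitSlice k s ≤ 1 := min_le_right _ _

/-- The slice `k + 2` lives where `s ≥ k + 2`, and there `s - (k + 1) ≥ 1`. This margin is the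
reason for the shift by two in `IsOneQuasitrace.re_unitSlice_le`. -/
theorem unitSlice_add_two_le (k : ℕ) (s : ℝ) :
    unitSlice (k + 2) s ≤ (s - (k + 1)) * unitSlice (k + 2) s := by
  rcases le_total s ((k + 2 : ℕ) : ℝ) with h | h
  · have : unitSlice (k + 2) s = 0 := by
      rw [unitSlice, max_eq_right (sub_nonpos.2 h)]; simp
    simp [this]
  · push_cast at h
    have := unitSlice_nonneg (k + 2) s
    nlinarith

theorem min_succ_eq_add_unitSlice {s : ℝ} (k : ℕ) :
    min s ((k + 1 : ℕ) : ℝ) = min s (k : ℝ) + unitSlice k s := by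
  unfold unitSlice
  push_cast
  rcases le_total s k with h | h
  · rw [min_eq_left (by linarith), min_eq_left h, max_eq_right (by linarith)]; simp
  · rw [min_eq_right h, max_eq_left (by linarith)]
    rcases le_total s (k + 1) with h' | h'
    · rw [min_eq_left h', min_eq_left (by linarith)]; ring
    · rw [min_eq_right h', min_eq_right (by linarith)]

theorem IsOneQuasitrace.re_min_succ (hτ : IsOneQuasitrace τ) (a : A) (k : ℕ) :
    (τ (cfc (fun s => min s ((k + 1 : ℕ) : ℝ)) a)).re =
      (τ (cfc (fun s => min s (k : ℝ)) a)).re + (τ (cfc (unitSlice k) a)).re := by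
  have h1 : Continuous fun s : ℝ => min s (k : ℝ) := by fun_prop
  rw [funext fun s => min_succ_eq_add_unitSlice (s := s) k,
    cfc_add a _ _ h1.continuousOn (continuous_unitSlice k).continuousOn]
  exact hτ.re_add (cfc_predicate _ a) (cfc_predicate _ a) (cfc_commute_cfc _ _ a)

theorem cfc_min_eq_self {a : A} (ha : IsSelfAdjoint a) {r : ℝ} (h : ‖a‖ ≤ r) :
    cfc (fun s => min s r) a = a := by
  nontriviality A
  nontriviality A
  conv_rhs => rw [← cfc_id' ℝ a]
  refine cfc_congr fun s hs => min_eq_left ?_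
  exact (le_abs_self s).trans ((spectrum.norm_le_norm_of_mem hs).trans h)

variable [PartialOrder A] [StarOrderedRing A]

theorem IsOneQuasitrace.map_nonneg (hτ : IsOneQuasitrace τ) {a : A} (ha : 0 ≤ a) :
    0 ≤ τ a := by
  obtain ⟨x, rfl⟩ := CStarAlgebra.nonneg_iff_eq_star_mul_self.1 ha
  exact hτ.nonneg x

theorem IsOneQuasitrace.re_nonneg (hτ : IsOneQuasitrace τ) {a : A} (ha : 0 ≤ a) :
    0 ≤ (τ a).re := (Complex.le_def.1 (hτ.map_nonneg ha)).1

theorem IsOneQuasitrace.re_le_of_commute (hτ : IsOneQuasitrace τ) {a b : A} (ha : IsSelfAdjoint a)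
    (hab : a ≤ b) (h : Commute a b) : (τ a).re ≤ (τ b).re := by
  have h0 : 0 ≤ b - a := sub_nonneg.2 hab
  have := hτ.re_add ha h0.isSelfAdjoint (h.sub_right (Commute.refl a))
  rw [add_sub_cancel] at this
  have := hτ.re_nonneg h0
  linarith

/-- By the C⋆-identity, `‖φ(D) q‖² = ‖φ(D) q² φ(D)‖ ≤ ‖φ(D) D φ(D)‖`. The factor `q` is thus worth a
factor `√s` in the functional calculus of `D`. -/
theorem norm_cfc_mul_le_of_mul_self_le {D q : A} (hD : 0 ≤ D) (hq : IsSelfAdjoint q)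
    (h : q * q ≤ D) {φ : ℝ → ℝ} (hφ : Continuous φ) {c : ℝ} (hc : 0 ≤ c)
    (hb : ∀ s : ℝ, 0 ≤ s → |φ s| * √s ≤ c) : ‖cfc φ D * q‖ ≤ c := by
  have hsa : IsSelfAdjoint (cfc φ D) := cfc_predicate φ D
  have h2 : cfc φ D * (q * q) * cfc φ D ≤ cfc φ D * D * cfc φ D :=
    hsa.conjugate_le_conjugate h
  rw [cfc_conjugate_self hD.isSelfAdjoint hφ] at h2
  have h4 : cfc φ D * q * star (cfc φ D * q) = cfc φ D * (q * q) * cfc φ D := by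
    rw [star_mul, hq.star_eq, hsa.star_eq]; simp only [mul_assoc]
  have h5 : 0 ≤ cfc φ D * q * star (cfc φ D * q) := mul_star_self_nonneg _
  refine (mul_self_le_mul_self_iff (norm_nonneg _) hc).2 ?_
  rw [← CStarRing.norm_self_mul_star, h4]
  rw [h4] at h5
  refine (CStarAlgebra.norm_le_norm_of_nonneg_of_le h5 h2).trans ?_
  refine norm_cfc_le (by positivity) fun s hs => ?_
  have hs0 : 0 ≤ s := spectrum_nonneg_of_nonneg hD hs
  have e : φ s * s * φ s = (|φ s| * √s) * (|φ s| * √s) := by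
    have h6 := Real.mul_self_sqrt hs0
    have h7 := abs_mul_abs_self (φ s)
    linear_combination (-s) * h7 - (|φ s| * |φ s|) * h6
  have h8 : 0 ≤ |φ s| * √s := by positivity
  rw [e, Real.norm_of_nonneg (by positivity)]
  exact mul_self_le_mul_self h8 (hb s hs0)

/-- A continuous substitute for `s ↦ (√s)⁻¹`. -/
noncomputable def invSqrtCut (ε s : ℝ) : ℝ := (max (√s) ε)⁻¹

theorem continuous_invSqrtCut {ε : ℝ} (hε : 0 < ε) : Continuous (invSqrtCut ε) :=
  Continuous.inv₀ (by fun_prop) fun _ => (lt_max_of_lt_right hε).ne'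

theorem abs_sqrt_sub_mul_invSqrtCut_le {ε : ℝ} (hε : 0 < ε) {s : ℝ} (hs : 0 ≤ s) :
    |√s - s * invSqrtCut ε s| ≤ ε := by
  have e : s = √s * √s := (Real.mul_self_sqrt hs).symm
  have h0 := Real.sqrt_nonneg s
  rcases le_total (√s) ε with hle | hle
  · have h1 : invSqrtCut ε s = ε⁻¹ := by simp only [invSqrtCut, max_eq_right hle]
    have h2 : √s * ε⁻¹ ≤ 1 := by
      rw [← div_eq_mul_inv]; exact div_le_one_of_le₀ hle hε.le
    have h3 : s * ε⁻¹ = √s * (√s * ε⁻¹) := by rw [← mul_assoc, ← e]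
    have h4 := mul_le_mul_of_nonneg_left h2 h0
    have h5 : 0 ≤ √s * (√s * ε⁻¹) := by positivity
    rw [h1, h3, abs_le]
    constructor <;> linarith
  · have h3 : invSqrtCut ε s = (√s)⁻¹ := by simp only [invSqrtCut, max_eq_left hle]
    have h4 : 0 < √s := lt_of_lt_of_le hε hle
    have h5 : s * (√s)⁻¹ = √s := by
      nth_rewrite 1 [e]; field_simp
    rw [h3, h5, sub_self, abs_zero]; exact hε.le

theorem one_sub_mul_invSqrtCut_bounds {ε : ℝ} (hε : 0 < ε) {s : ℝ} (hs : 0 ≤ s) :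
    0 ≤ 1 - invSqrtCut ε s * s * invSqrtCut ε s ∧
      (1 - invSqrtCut ε s * s * invSqrtCut ε s) * s ≤ ε ^ 2 := by
  have e := Real.mul_self_sqrt hs
  have h0 := Real.sqrt_nonneg s
  rcases le_total (√s) ε with hle | hle
  · have h1 : invSqrtCut ε s = ε⁻¹ := by simp only [invSqrtCut, max_eq_right hle]
    have h2 : √s * ε⁻¹ ≤ 1 := by
      rw [← div_eq_mul_inv]; exact div_le_one_of_le₀ hle hε.le
    have h5 : ε⁻¹ * s * ε⁻¹ = (√s * ε⁻¹) * (√s * ε⁻¹) := by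
      linear_combination (-(ε⁻¹) ^ 2) * e
    have h6 : 0 ≤ √s * ε⁻¹ := by positivity
    have h7 := mul_le_one₀ h2 h6 h2
    have h8 : s ≤ ε ^ 2 := by rw [← e, sq]; exact mul_self_le_mul_self h0 hle
    rw [h1, h5]
    refine ⟨by linarith, ?_⟩
    have h9 : 0 ≤ (√s * ε⁻¹) * (√s * ε⁻¹) * s := by positivity
    linarith
  · have h3 : invSqrtCut ε s = (√s)⁻¹ := by simp only [invSqrtCut, max_eq_left hle]
    have h4 : 0 < √s := lt_of_lt_of_le hε hle
    have h5 : (√s)⁻¹ * s * (√s)⁻¹ = 1 := by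
      nth_rewrite 2 [← e]; field_simp
    rw [h3, h5]; simp; positivity

/-- Polar decomposition substitute: if `q² ≤ y⋆y` then `q² = x⋆x` for some `x` in the closed right
ideal generated by `y`. -/
theorem exists_star_mul_self_eq_of_mul_self_le {y q : A} (hq : IsSelfAdjoint q)
    (h : q * q ≤ star y * y) :
    ∃ x : A, star x * x = q * q ∧ ∀ g : A, g * y = y → g * x = x := by
  set D : A := star y * y with hD
  have hD0 : 0 ≤ D := star_mul_self_nonneg y
  have hDsa : IsSelfAdjoint D := hD0.isSelfAdjoint
  let ε : ℕ → ℝ := fun n => 1 / (n + 1 : ℝ)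
  have hε : ∀ n, 0 < ε n := fun n => by positivity
  have hε0 : Tendsto ε atTop (𝓝 0) := tendsto_one_div_add_atTop_nhds_zero_nat
  let ψ : ℕ → ℝ → ℝ := fun n => invSqrtCut (ε n)
  have hψ : ∀ n, Continuous (ψ n) := fun n => continuous_invSqrtCut (hε n)
  -- Formally the limit is `y D^(-1/2) q`, the partial isometry of `y` applied to `q`. The cut-off
  -- `ψ n` stands for `D^(-1/2)`, and `q² ≤ D` makes the sequence Cauchy although `D` need not be
  -- invertible.
  let x : ℕ → A := fun n => y * (cfc (ψ n) D * q)
  have hnorm : ∀ n m, ‖x n - x m‖ ≤ ε n + ε m := by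
    intro n m
    have hφ : Continuous fun s => ψ n s - ψ m s := (hψ n).sub (hψ m)
    have hr : Continuous fun s => √s * (ψ n s - ψ m s) := Real.continuous_sqrt.mul hφ
    have e1 : x n - x m = y * (cfc (fun s => ψ n s - ψ m s) D * q) := by
      rw [cfc_sub (ψ n) (ψ m) D (hψ n).continuousOn (hψ m).continuousOn]
      simp only [x]; noncomm_ring
    have e2 : star (x n - x m) * (x n - x m) =
        star (cfc (fun s => √s * (ψ n s - ψ m s)) D * q) *
          (cfc (fun s => √s * (ψ n s - ψ m s)) D * q) := by
      have e3 : cfc (fun s => ψ n s - ψ m s) D * D * cfc (fun s => ψ n s - ψ m s) D =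
          cfc (fun s => √s * (ψ n s - ψ m s)) D * cfc (fun s => √s * (ψ n s - ψ m s)) D := by
        rw [cfc_conjugate_self hDsa hφ, ← cfc_mul _ _ D hr.continuousOn hr.continuousOn]
        refine cfc_congr fun s hs => ?_
        have := Real.mul_self_sqrt (spectrum_nonneg_of_nonneg hD0 hs)
        linear_combination (-(ψ n s - ψ m s) ^ 2) * this
      rw [e1, star_mul, star_mul, star_mul, star_cfc_real, star_cfc_real]
      calc _ = star q * (cfc (fun s => ψ n s - ψ m s) D * D *
            cfc (fun s => ψ n s - ψ m s) D) * q := by rw [hD]; simp only [mul_assoc]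
        _ = _ := by rw [e3]; simp only [mul_assoc]
    have hε' : 0 ≤ ε n + ε m := (add_pos (hε n) (hε m)).le
    refine (mul_self_le_mul_self_iff (norm_nonneg _) hε').2 ?_
    rw [← CStarRing.norm_star_mul_self, e2, CStarRing.norm_star_mul_self]
    have : ‖cfc (fun s => √s * (ψ n s - ψ m s)) D * q‖ ≤ ε n + ε m := by
      refine norm_cfc_mul_le_of_mul_self_le hD0 hq h hr hε' fun s hs => ?_
      have h1 := abs_le.1 (abs_sqrt_sub_mul_invSqrtCut_le (hε n) hs)
      have h2 := abs_le.1 (abs_sqrt_sub_mul_invSqrtCut_le (hε m) hs)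
      have e3 : |√s * (ψ n s - ψ m s)| * √s =
          |(√s - s * ψ m s) - (√s - s * ψ n s)| := by
        rw [← abs_of_nonneg (Real.sqrt_nonneg s), ← abs_mul, abs_of_nonneg (Real.sqrt_nonneg s)]
        congr 1
        linear_combination (ψ n s - ψ m s) * Real.mul_self_sqrt hs
      rw [e3, abs_le]
      constructor <;> linarith
    exact mul_self_le_mul_self (norm_nonneg _) this
  have hcau : CauchySeq x := by
    refine cauchySeq_of_le_tendsto_0 (fun n => ε n + ε n) (fun n m N hn hm => ?_)
      (by simpa using hε0.add hε0)
    rw [dist_eq_norm]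
    refine (hnorm n m).trans (add_le_add ?_ ?_) <;> simp only [ε] <;> gcongr
  obtain ⟨X, hX⟩ := cauchySeq_tendsto_of_complete hcau
  refine ⟨X, ?_, fun g hg => ?_⟩
  · have l1 : Tendsto (fun n => star (x n) * x n) atTop (𝓝 (star X * X)) := hX.star.mul hX
    refine tendsto_nhds_unique l1 ?_
    rw [tendsto_iff_norm_sub_tendsto_zero]
    refine squeeze_zero (fun _ => norm_nonneg _) (fun n => ?_)
      (by simpa using hε0.mul hε0)
    have hκ : Continuous fun s => ψ n s * s * ψ n s := ((hψ n).mul continuous_id).mul (hψ n)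
    have hρ : Continuous fun s => √(1 - ψ n s * s * ψ n s) :=
      Real.continuous_sqrt.comp (continuous_const.sub hκ)
    -- The error `q (1 - κ(D)) q`, with `κ(s) = ψ(s) s ψ(s) ≤ 1` on the spectrum, is written as a
    -- square so that the norm estimate above applies.
    have e1 : q * q - star (x n) * x n =
        star (cfc (fun s => √(1 - ψ n s * s * ψ n s)) D * q) *
          (cfc (fun s => √(1 - ψ n s * s * ψ n s)) D * q) := by
      have h1 : cfc (fun s => √(1 - ψ n s * s * ψ n s)) D *
          cfc (fun s => √(1 - ψ n s * s * ψ n s)) D = 1 - cfc (ψ n) D * D * cfc (ψ n) D := by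
        rw [cfc_conjugate_self hDsa (hψ n), ← cfc_mul _ _ D hρ.continuousOn hρ.continuousOn,
          ← cfc_const_one ℝ D, ← cfc_sub _ _ D continuous_const.continuousOn hκ.continuousOn]
        refine cfc_congr fun s hs => ?_
        exact Real.mul_self_sqrt
          (one_sub_mul_invSqrtCut_bounds (hε n) (spectrum_nonneg_of_nonneg hD0 hs)).1
      calc q * q - star (x n) * x n
          = q * (1 - cfc (ψ n) D * D * cfc (ψ n) D) * q := by
            simp only [x, star_mul, star_cfc_real, hq.star_eq, hD]; noncomm_ring
        _ = _ := by rw [← h1, star_mul, star_cfc_real, hq.star_eq]; simp only [mul_assoc]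
    rw [norm_sub_rev, e1, CStarRing.norm_star_mul_self]
    have : ‖cfc (fun s => √(1 - ψ n s * s * ψ n s)) D * q‖ ≤ ε n := by
      refine norm_cfc_mul_le_of_mul_self_le hD0 hq h hρ (hε n).le fun s hs => ?_
      have h1 := one_sub_mul_invSqrtCut_bounds (hε n) hs
      rw [abs_of_nonneg (Real.sqrt_nonneg _), ← Real.sqrt_mul h1.1]
      exact (Real.sqrt_le_left (hε n).le).2 h1.2
    exact mul_self_le_mul_self (norm_nonneg _) this
  · refine tendsto_nhds_unique (hX.const_mul g) ?_
    refine hX.congr fun n => ?_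
    simp only [x]; rw [← mul_assoc g, hg]

/-- Comparison: an element `x` absorbed by the positive element `g` satisfies
`τ (x⋆x) ≤ τ g`, provided that `‖x‖ ≤ 1`. -/
theorem IsOneQuasitrace.re_star_mul_self_le_of_absorb (hτ : IsOneQuasitrace τ) {x g : A}
    (hg : 0 ≤ g) (hx : ‖x‖ ≤ 1) (h : g * x = x) : (τ (star x * x)).re ≤ (τ g).re := by
  have h1 : g * (x * star x) = x * star x := by rw [← mul_assoc, h]
  have h2 : x * star x * g = x * star x := by
    simpa [hg.isSelfAdjoint.star_eq, mul_assoc] using congrArg star h1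
  have hc : Commute g (x * star x) := h1.trans h2.symm
  have h3 : x * star x ≤ 1 := by
    have h4 : 0 ≤ x * star x := mul_star_self_nonneg x
    have := (CStarAlgebra.norm_le_iff_le_algebraMap (x * star x) zero_le_one h4).1 (by
      rw [CStarRing.norm_self_mul_star]; exact mul_le_one₀ hx (norm_nonneg _) hx)
    simpa using this
  -- A product of commuting positive elements, equal to `g - xx⋆`. Hence `xx⋆ ≤ g` inside a
  -- commutative algebra, where `τ` is additive.
  have h5 : 0 ≤ g * (1 - x * star x) :=
    Commute.mul_nonneg hg (sub_nonneg.2 h3) ((Commute.one_right g).sub_right hc)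
  rw [mul_sub, mul_one, h1] at h5
  rw [hτ.star_mul_comm]
  exact hτ.re_le_of_commute (mul_star_self_nonneg x).isSelfAdjoint (sub_nonneg.1 h5) hc.symm

/-- With `q²` the upper slice of `a` and `r² = (b - (k + 1))₊`, the chain `q² ≤ q (a - (k + 1)) q ≤
(r q)⋆(r q)` gives `q² = x⋆x` with `x` in the closed right ideal of `r q`. The lower slice of `b` is
`1` on the support of `r`, so it absorbs `x`, and the trace property finishes. -/
theorem IsOneQuasitrace.re_unitSlice_le (hτ : IsOneQuasitrace τ) {a b : A} (ha : IsSelfAdjoint a)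
    (hab : a ≤ b) (k : ℕ) :
    (τ (cfc (unitSlice (k + 2)) a)).re ≤ (τ (cfc (unitSlice k) b)).re := by
  have hb : IsSelfAdjoint b := by
    have := (sub_nonneg.2 hab).isSelfAdjoint.add ha
    rwa [sub_add_cancel] at this
  have hσ := continuous_unitSlice (k + 2)
  set q : A := cfc (fun s => √(unitSlice (k + 2) s)) a with hqd
  have hqc : Continuous fun s => √(unitSlice (k + 2) s) := by fun_prop
  have hq : IsSelfAdjoint q := cfc_predicate _ a
  have hqq : q * q = cfc (unitSlice (k + 2)) a := by
    rw [hqd, ← cfc_mul _ _ a hqc.continuousOn hqc.continuousOn]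
    exact cfc_congr fun s _ => Real.mul_self_sqrt (unitSlice_nonneg _ _)
  have hqn : ‖q‖ ≤ 1 := by
    refine norm_cfc_le zero_le_one fun s _ => ?_
    rw [Real.norm_of_nonneg (Real.sqrt_nonneg _)]
    exact Real.sqrt_le_one.2 (unitSlice_le_one _ _)
  set r : A := cfc (fun s : ℝ => √(max (s - (k + 1)) 0)) b with hr
  have hrc : Continuous fun s : ℝ => √(max (s - (k + 1)) 0) := by fun_prop
  have hrsa : star r = r := star_cfc_real _ _
  have hrr : r * r = cfc (fun s : ℝ => max (s - (k + 1)) 0) b := by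
    rw [hr, ← cfc_mul _ _ b hrc.continuousOn hrc.continuousOn]
    exact cfc_congr fun s _ => Real.mul_self_sqrt (le_max_right _ _)
  have hsub : ∀ c : A, IsSelfAdjoint c →
      cfc (fun s : ℝ => s - (k + 1)) c = c - algebraMap ℝ A (k + 1) := by
    intro c hc
    rw [cfc_sub (fun s : ℝ => s) (fun _ => (k + 1 : ℝ)) c continuous_id.continuousOn
      continuous_const.continuousOn, cfc_id' ℝ c, cfc_const _ c]
  have h1 : a - algebraMap ℝ A (k + 1) ≤ r * r := by
    refine (sub_le_sub_right hab _).trans ?_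
    rw [hrr, ← hsub b hb]
    exact cfc_mono (fun s _ => le_max_left _ _) (by fun_prop) (by fun_prop)
  have h2 : q * q ≤ star (r * q) * (r * q) := by
    have h3 : q * (a - algebraMap ℝ A (k + 1)) * q ≤ q * (r * r) * q :=
      hq.conjugate_le_conjugate h1
    have h4 : star (r * q) * (r * q) = q * (r * r) * q := by
      rw [star_mul, hrsa, hq.star_eq]; simp only [mul_assoc]
    rw [h4]
    refine le_trans ?_ h3
    have hl : Continuous fun s : ℝ => s - (k + 1) := by fun_prop
    have hql : Continuous fun s => √(unitSlice (k + 2) s) * (s - (k + 1)) := hqc.mul hl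
    rw [hqq, ← hsub a ha, hqd, ← cfc_mul _ _ a hqc.continuousOn hl.continuousOn,
      ← cfc_mul _ _ a hql.continuousOn hqc.continuousOn]
    refine cfc_mono (fun s _ => ?_) hσ.continuousOn (hql.mul hqc).continuousOn
    have e : √(unitSlice (k + 2) s) * (s - (k + 1)) * √(unitSlice (k + 2) s) =
        (s - (k + 1)) * unitSlice (k + 2) s := by
      linear_combination (s - (k + 1)) * Real.mul_self_sqrt (unitSlice_nonneg (k + 2) s)
    rw [e]; exact unitSlice_add_two_le k s
  obtain ⟨x, hx, hxg⟩ := exists_star_mul_self_eq_of_mul_self_le hq h2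
  rw [← hqq, ← hx]
  refine hτ.re_star_mul_self_le_of_absorb (cfc_nonneg fun s _ => unitSlice_nonneg k s) ?_
    (hxg _ ?_)
  · refine (mul_self_le_mul_self_iff (norm_nonneg _) zero_le_one).2 ?_
    rw [← CStarRing.norm_star_mul_self, hx]
    exact (norm_mul_le _ _).trans (mul_self_le_mul_self (norm_nonneg _) hqn)
  · rw [← mul_assoc, hr, ← cfc_mul _ _ b (continuous_unitSlice k).continuousOn hrc.continuousOn]
    congr 1
    refine cfc_congr fun s _ => ?_
    rcases le_total s (k + 1) with h | h
    · simp [max_eq_right (sub_nonpos.2 h)]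
    · have : unitSlice k s = 1 := by
        unfold unitSlice
        rw [max_eq_left (by linarith), min_eq_right (by linarith)]
      simp [this]

/-- Slices are compared one by one. The two lowest slices of `a` have no partner and cost at most `2
τ 1`. -/
theorem IsOneQuasitrace.re_min_le (hτ : IsOneQuasitrace τ) {a b : A} (ha : 0 ≤ a)
    (hab : a ≤ b) (k : ℕ) :
    (τ (cfc (fun s => min s ((k + 2 : ℕ) : ℝ)) a)).re ≤
      2 * (τ 1).re + (τ (cfc (fun s => min s (k : ℝ)) b)).re := by
  induction k with
  | zero =>
    have hb := ha.trans hab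
    have h1 : (τ (cfc (fun s => min s ((0 + 2 : ℕ) : ℝ)) a)).re ≤
        (τ ((2 : ℝ) • (1 : A))).re := by
      refine hτ.re_le_of_commute (cfc_predicate _ a) ?_ ((Commute.one_right _).smul_right _)
      rw [← Algebra.algebraMap_eq_smul_one]
      exact cfc_le_algebraMap _ _ a (fun s _ => by simp) (by fun_prop) ha.isSelfAdjoint
    have h2 : cfc (fun s => min s ((0 : ℕ) : ℝ)) b = 0 := by
      rw [← cfc_const_zero ℝ b]
      exact cfc_congr fun s hs => by simpa using spectrum_nonneg_of_nonneg hb hs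
    rw [hτ.re_smul (.one A)] at h1
    rw [h2, hτ.map_zero]
    simpa using h1
  | succ k ih =>
    rw [hτ.re_min_succ b k, show k + 1 + 2 = (k + 2) + 1 from rfl, hτ.re_min_succ a (k + 2)]
    have := hτ.re_unitSlice_le ha.isSelfAdjoint hab k
    linarith

theorem IsOneQuasitrace.re_le_add (hτ : IsOneQuasitrace τ) {a b : A} (ha : 0 ≤ a)
    (hab : a ≤ b) : (τ a).re ≤ 2 * (τ 1).re + (τ b).re := by
  obtain ⟨k, hk⟩ := exists_nat_ge (max ‖a‖ ‖b‖)
  have h1 := hτ.re_min_le ha hab k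
  rwa [cfc_min_eq_self ha.isSelfAdjoint (((le_max_left _ _).trans hk).trans (by push_cast; linarith)),
    cfc_min_eq_self (ha.trans hab).isSelfAdjoint ((le_max_right _ _).trans hk)] at h1

/-- A `1`-quasitrace is monotone. -/
theorem IsOneQuasitrace.re_mono (hτ : IsOneQuasitrace τ) {a b : A} (ha : 0 ≤ a)
    (hab : a ≤ b) : (τ a).re ≤ (τ b).re := by
  -- The additive error does not scale with `n`, so the Archimedean property removes it.
  have h : ∀ n : ℕ, (n : ℝ) * ((τ a).re - (τ b).re) ≤ 2 * (τ 1).re := by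
    intro n
    have h1 := hτ.re_le_add (a := (n : ℝ) • a) (b := (n : ℝ) • b)
      (smul_nonneg (by positivity) ha) (smul_le_smul_of_nonneg_left hab (by positivity))
    rw [hτ.re_smul ha.isSelfAdjoint, hτ.re_smul (ha.trans hab).isSelfAdjoint] at h1
    linarith
  by_contra! hlt
  obtain ⟨n, hn⟩ := exists_nat_gt (2 * (τ 1).re / ((τ a).re - (τ b).re))
  rw [div_lt_iff₀ (sub_pos.2 hlt)] at hn
  exact absurd (h n) (not_le.2 hn)

end OneQuasitrace

/-! ### Subadditivity through `M₂(M)`. -/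

section TwoByTwo

variable {M : Type*} [CStarAlgebra M]

/-- The element `x ⊗ eᵢⱼ` of `M₂(M)`. -/
def tensorUnit (i j : Fin 2) (x : M) : CStarMatrix (Fin 2) (Fin 2) M :=
  CStarMatrix.ofMatrix (Matrix.single i j x)

theorem tensorUnit_add (i j : Fin 2) (x y : M) :
    tensorUnit i j (x + y) = tensorUnit i j x + tensorUnit i j y :=
  Matrix.single_add i j x y

theorem tensorUnit_smul (i j : Fin 2) (r : ℝ) (x : M) :
    tensorUnit i j (r • x) = r • tensorUnit i j x :=
  (Matrix.smul_single r i j x).symm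

theorem star_tensorUnit (i j : Fin 2) (x : M) :
    star (tensorUnit i j x) = tensorUnit j i (star x) :=
  Matrix.conjTranspose_single i j x

theorem tensorUnit_mul_same (i j k : Fin 2) (x y : M) :
    tensorUnit i j x * tensorUnit j k y = tensorUnit i k (x * y) :=
  Matrix.single_mul_single_same x i j k y

theorem tensorUnit_mul_of_ne {i j k l : Fin 2} (h : j ≠ k) (x y : M) :
    tensorUnit i j x * tensorUnit k l y = 0 :=
  Matrix.single_mul_single_of_ne x i j k h y

variable [PartialOrder M] [StarOrderedRing M] {τ : M → ℂ}

/-- Approximate subadditivity of a quasitrace; optimizing over `r` gives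
`τ (a + b) ^ (1/2) ≤ τ a ^ (1/2) + τ b ^ (1/2)` for positive `a` and `b`. -/
theorem IsQuasitrace.re_star_mul_self_add_le (hτ : IsQuasitrace τ) (x y : M) {r : ℝ}
    (hr : 0 < r) : (τ (star x * x + star y * y)).re ≤
      (1 + r) * (τ (star x * x)).re + (1 + r⁻¹) * (τ (star y * y)).re := by
  obtain ⟨τ₂, h₂, hτ₂⟩ := hτ.exists_two
  let _ : PartialOrder (CStarMatrix (Fin 2) (Fin 2) M) := CStarAlgebra.spectralOrder _
  have : StarOrderedRing (CStarMatrix (Fin 2) (Fin 2) M) := CStarAlgebra.spectralOrderedRing _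
  have h01 : (0 : Fin 2) ≠ 1 := by decide
  have h10 : (1 : Fin 2) ≠ 0 := by decide
  -- For this column, `X⋆X` carries the sum `x⋆x + y⋆y`, while `XX⋆` has `xx⋆` and `yy⋆` in
  -- orthogonal corners, up to off-diagonal terms.
  set X := tensorUnit 0 0 x + tensorUnit 1 0 y with hX
  have e1 : star X * X = tensorUnit 0 0 (star x * x + star y * y) := by
    simp only [hX, star_add, star_tensorUnit, add_mul, mul_add, tensorUnit_mul_same,
      tensorUnit_mul_of_ne h01, tensorUnit_mul_of_ne h10, tensorUnit_add, add_zero, zero_add]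
  have e2 : X * star X = tensorUnit 0 0 (x * star x) + tensorUnit 0 1 (x * star y) +
      (tensorUnit 1 0 (y * star x) + tensorUnit 1 1 (y * star y)) := by
    simp only [hX, star_add, star_tensorUnit, add_mul, mul_add, tensorUnit_mul_same]
    abel
  set P := tensorUnit 0 0 (x * star x) with hP
  set Q := tensorUnit 1 1 (y * star y) with hQ
  have hPsa : IsSelfAdjoint P := by
    rw [hP, isSelfAdjoint_iff, star_tensorUnit, star_mul, star_star]
  have hQsa : IsSelfAdjoint Q := by
    rw [hQ, isSelfAdjoint_iff, star_tensorUnit, star_mul, star_star]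
  -- The weights are chosen so that the off-diagonal part of `W W⋆` is minus that of `X X⋆`.
  set W := tensorUnit 0 0 (√r • x) + tensorUnit 1 0 ((-(√r)⁻¹) • y) with hW
  have hsr : √r * √r = r := Real.mul_self_sqrt hr.le
  have hsr0 : √r ≠ 0 := (Real.sqrt_pos.2 hr).ne'
  have hsr' : -(√r)⁻¹ * -(√r)⁻¹ = r⁻¹ := by rw [neg_mul_neg, ← mul_inv, hsr]
  have e3 : (1 + r) • P + (1 + r⁻¹) • Q - X * star X = W * star W := by
    simp only [e2, hW, star_add, star_tensorUnit, add_mul, mul_add, tensorUnit_mul_same, star_smul,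
      star_trivial, smul_mul_smul_comm, hsr, hsr', tensorUnit_smul, add_smul, one_smul]
    rw [mul_neg, neg_mul, mul_inv_cancel₀ hsr0, inv_mul_cancel₀ hsr0]
    simp only [neg_smul, one_smul]
    abel
  have e4 : X * star X ≤ (1 + r) • P + (1 + r⁻¹) • Q := by
    rw [← sub_nonneg, e3]; exact mul_star_self_nonneg W
  have hPQ : Commute P Q := by
    rw [hP, hQ, Commute, SemiconjBy, tensorUnit_mul_of_ne h01, tensorUnit_mul_of_ne h10]
  have hs : ∀ (t : ℝ) {a : CStarMatrix (Fin 2) (Fin 2) M}, IsSelfAdjoint a →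
      (τ₂ (t • a)).re = t * (τ₂ a).re := fun t _ ha => h₂.re_smul ha t
  have h1 := h₂.re_mono (mul_star_self_nonneg X) e4
  rw [h₂.re_add (.smul (.all (1 + r)) hPsa) (.smul (.all (1 + r⁻¹)) hQsa)
    ((hPQ.smul_left _).smul_right _), hs _ hPsa, hs _ hQsa, ← h₂.star_mul_comm X,
    e1] at h1
  have h3 : τ₂ Q = τ (star y * y) := by
    have := h₂.star_mul_comm (tensorUnit 1 0 y)
    rw [star_tensorUnit, tensorUnit_mul_same, tensorUnit_mul_same] at this
    rw [hQ, ← this]; exact (hτ₂ _).symm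
  have h4 : τ₂ P = τ (star x * x) := by
    rw [hτ.star_mul_comm]; exact (hτ₂ _).symm
  rw [h3, h4] at h1
  rw [hτ₂]; exact h1

end TwoByTwo

/-! ### The 2-quasinorm and its triangle inequality. -/

section Norm

variable {M : Type*} [CStarAlgebra M] {τ : M → ℂ}

theorem IsOneQuasitrace.norm₂_sq (hτ : IsOneQuasitrace τ) (x : M) :
    norm₂ τ x ^ 2 = (τ (star x * x)).re :=
  Real.sq_sqrt (hτ.re_star_mul_self_nonneg x)

theorem norm₂_nonneg (τ : M → ℂ) (x : M) : 0 ≤ norm₂ τ x := Real.sqrt_nonneg _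

theorem norm₂_neg (τ : M → ℂ) (x : M) : norm₂ τ (-x) = norm₂ τ x := by simp [norm₂]

theorem norm₂_sub_comm (τ : M → ℂ) (x y : M) : norm₂ τ (x - y) = norm₂ τ (y - x) := by
  rw [← norm₂_neg, neg_sub]

theorem IsOneQuasitrace.norm₂_star (hτ : IsOneQuasitrace τ) (x : M) :
    norm₂ τ (star x) = norm₂ τ x := by
  rw [norm₂, norm₂, star_star, hτ.star_mul_comm x]

theorem IsOneQuasitrace.norm₂_zero (hτ : IsOneQuasitrace τ) : norm₂ τ 0 = 0 := by
  simp [norm₂, hτ.map_zero]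

theorem IsOneQuasitrace.norm₂_eq_zero (hτ : IsOneQuasitrace τ) (hf : IsFaithful τ) {x : M} :
    norm₂ τ x = 0 ↔ x = 0 := by
  refine ⟨fun h => ?_, fun h => h ▸ hτ.norm₂_zero⟩
  have h1 : (τ (star x * x)).re = 0 := by rw [← hτ.norm₂_sq, h]; simp
  exact hf x (Complex.ext h1 (Complex.le_def.1 (hτ.nonneg x)).2.symm)

theorem IsOneQuasitrace.norm₂_smul (hτ : IsOneQuasitrace τ) (r : ℝ) (x : M) :
    norm₂ τ (r • x) = |r| * norm₂ τ x := by
  rw [norm₂, star_smul, star_trivial, smul_mul_smul_comm, hτ.re_smul (.star_mul_self x),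
    Real.sqrt_mul (mul_self_nonneg r), Real.sqrt_mul_self_eq_abs]
  rfl

variable [PartialOrder M] [StarOrderedRing M]

theorem IsOneQuasitrace.norm₂_mul_le (hτ : IsOneQuasitrace τ) (a x : M) :
    norm₂ τ (a * x) ≤ ‖a‖ * norm₂ τ x := by
  have h1 : star (a * x) * (a * x) ≤ (‖a‖ ^ 2) • (star x * x) := by
    have := star_left_conjugate_le_conjugate
      (CStarAlgebra.star_mul_le_algebraMap_norm_sq (a := a)) x
    rw [Algebra.algebraMap_eq_smul_one, mul_smul_comm, mul_one, smul_mul_assoc] at this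
    rw [star_mul]; simpa only [mul_assoc] using this
  have h2 := hτ.re_mono (star_mul_self_nonneg _) h1
  rw [hτ.re_smul (.star_mul_self x)] at h2
  rw [norm₂, norm₂, ← Real.sqrt_sq (norm_nonneg a), ← Real.sqrt_mul (by positivity)]
  exact Real.sqrt_le_sqrt h2

theorem IsOneQuasitrace.norm₂_mul_le' (hτ : IsOneQuasitrace τ) (x a : M) :
    norm₂ τ (x * a) ≤ norm₂ τ x * ‖a‖ := by
  rw [← hτ.norm₂_star (x * a), star_mul, ← hτ.norm₂_star x, mul_comm, ← norm_star a]
  exact hτ.norm₂_mul_le _ _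

theorem IsOneQuasitrace.norm₂_le (hτ : IsOneQuasitrace τ) (x : M) :
    norm₂ τ x ≤ ‖x‖ * norm₂ τ 1 := by
  simpa using hτ.norm₂_mul_le x 1

/-- The weights are squared because they enter twice: in the operator inequality `(x + y)⋆(x + y) ≤
(1 + r) x⋆x + (1 + r⁻¹) y⋆y`, and in the approximate subadditivity of `τ`. -/
theorem IsQuasitrace.norm₂_add_sq_le (hτ : IsQuasitrace τ) (x y : M) {r : ℝ} (hr : 0 < r) :
    norm₂ τ (x + y) ^ 2 ≤ (1 + r) ^ 2 * norm₂ τ x ^ 2 + (1 + r⁻¹) ^ 2 * norm₂ τ y ^ 2 := by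
  have h1 : star (x + y) * (x + y) ≤ star (√(1 + r) • x) * (√(1 + r) • x) +
      star (√(1 + r⁻¹) • y) * (√(1 + r⁻¹) • y) := by
    have hsr : √r * √r = r := Real.mul_self_sqrt hr.le
    have hsr0 : √r ≠ 0 := (Real.sqrt_pos.2 hr).ne'
    have hsr' : (√r)⁻¹ * (√r)⁻¹ = r⁻¹ := by rw [← mul_inv, hsr]
    have hi : 0 < r⁻¹ := inv_pos.2 hr
    rw [← sub_nonneg]
    have e : star (√(1 + r) • x) * (√(1 + r) • x) +
        star (√(1 + r⁻¹) • y) * (√(1 + r⁻¹) • y) - star (x + y) * (x + y) =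
        star (√r • x - (√r)⁻¹ • y) * (√r • x - (√r)⁻¹ • y) := by
      simp only [star_sub, star_add, star_smul, star_trivial, smul_mul_smul_comm, sub_mul, mul_sub,
        add_mul, mul_add, hsr, hsr', Real.mul_self_sqrt (by linarith : 0 ≤ 1 + r),
        Real.mul_self_sqrt (by linarith : 0 ≤ 1 + r⁻¹), mul_inv_cancel₀ hsr0,
        inv_mul_cancel₀ hsr0, add_smul, one_smul]
      abel
    rw [e]; exact star_mul_self_nonneg _
  have h2 := (hτ.re_mono (star_mul_self_nonneg _) h1).trans
    (hτ.re_star_mul_self_add_le _ _ hr)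
  simp only [← hτ.norm₂_sq, hτ.norm₂_smul, mul_pow, sq_abs] at h2
  have hi : 0 < r⁻¹ := inv_pos.2 hr
  rw [Real.sq_sqrt (by linarith), Real.sq_sqrt (by linarith)] at h2
  linarith

theorem IsQuasitrace.norm₂_add_le (hτ : IsQuasitrace τ) (x y : M) :
    norm₂ τ (x + y) ≤ 2 * (norm₂ τ x + norm₂ τ y) := by
  have h := hτ.norm₂_add_sq_le x y one_pos
  have hx := norm₂_nonneg τ x
  have hy := norm₂_nonneg τ y
  refine le_of_sq_le_sq ?_ (by positivity)
  norm_num at h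
  nlinarith [mul_nonneg hx hy]

theorem IsQuasitrace.norm₂_add_rpow_le (hτ : IsQuasitrace τ) (hf : IsFaithful τ) (x y : M) :
    norm₂ τ (x + y) ^ (2 / 3 : ℝ) ≤ norm₂ τ x ^ (2 / 3 : ℝ) + norm₂ τ y ^ (2 / 3 : ℝ) := by
  rcases (norm₂_nonneg τ x).eq_or_lt with hx | hx
  · have : x = 0 := (hτ.norm₂_eq_zero hf).1 hx.symm
    subst this
    rw [zero_add]
    exact le_add_of_nonneg_left (Real.rpow_nonneg (norm₂_nonneg _ _) _)
  rcases (norm₂_nonneg τ y).eq_or_lt with hy | hy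
  · have : y = 0 := (hτ.norm₂_eq_zero hf).1 hy.symm
    subst this
    rw [add_zero]
    exact le_add_of_nonneg_right (Real.rpow_nonneg (norm₂_nonneg _ _) _)
  set α := norm₂ τ x ^ (2 / 3 : ℝ) with hα
  set β := norm₂ τ y ^ (2 / 3 : ℝ) with hβ
  have hα0 : 0 < α := Real.rpow_pos_of_pos hx _
  have hβ0 : 0 < β := Real.rpow_pos_of_pos hy _
  have cube : ∀ t : ℝ, 0 ≤ t → (t ^ (2 / 3 : ℝ)) ^ 3 = t ^ 2 := by
    intro t ht
    rw [← Real.rpow_natCast, ← Real.rpow_mul ht, ← Real.rpow_natCast]; norm_num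
  -- With `r = β / α` the bound is `(α + β)² α + (α + β)² β = (α + β)³`. This is where the exponent
  -- `2/3` comes from.
  have h := hτ.norm₂_add_sq_le x y (div_pos hβ0 hα0)
  rw [← cube _ hx.le, ← cube _ hy.le, ← cube _ (norm₂_nonneg _ _), ← hα, ← hβ] at h
  refine le_of_pow_le_pow_left₀ (n := 3) (by norm_num) (by positivity) (h.trans_eq ?_)
  field_simp
  ring

end Norm

/-! ### Null sequences for the 2-quasinorm. -/

section Null

variable {M ι : Type*} [CStarAlgebra M] {τ : M → ℂ} {l : Filter ι} {u v : ι → M}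

/-- Convergence to zero in the `2`-quasinorm of a quasitrace. -/
def IsNull (τ : M → ℂ) (l : Filter ι) (u : ι → M) : Prop :=
  Tendsto (fun i => norm₂ τ (u i)) l (𝓝 0)

theorem IsNull.comp {κ : Type*} {l' : Filter κ} {φ : κ → ι} (hu : IsNull τ l u)
    (h : Tendsto φ l' l) : IsNull τ l' (fun k => u (φ k)) :=
  Tendsto.comp (g := fun i => norm₂ τ (u i)) hu h

theorem IsNull.of_le {c : ι → ℝ} (h : ∀ᶠ i in l, norm₂ τ (u i) ≤ c i) (hc : Tendsto c l (𝓝 0)) :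
    IsNull τ l u :=
  squeeze_zero' (.of_forall fun _ => norm₂_nonneg τ _) h hc

protected theorem IsNull.neg (hu : IsNull τ l u) : IsNull τ l (fun i => -u i) := by
  simpa only [IsNull, norm₂_neg] using hu

protected theorem IsNull.star (hu : IsNull τ l u) (hτ : IsOneQuasitrace τ) :
    IsNull τ l (fun i => star (u i)) := by
  simpa only [IsNull, hτ.norm₂_star] using hu

theorem IsOneQuasitrace.isNull_zero (hτ : IsOneQuasitrace τ) : IsNull τ l (fun _ => (0 : M)) := by
  simpa only [IsNull, hτ.norm₂_zero] using tendsto_const_nhds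

theorem IsNull.eq_zero [l.NeBot] {x : M} (h : IsNull τ l (fun _ => x)) (hτ : IsOneQuasitrace τ)
    (hf : IsFaithful τ) : x = 0 :=
  (hτ.norm₂_eq_zero hf).1 (tendsto_nhds_unique tendsto_const_nhds h)

/-- Cauchy sequences for the `2`-quasinorm. -/
def IsCauchy₂ (τ : M → ℂ) (x : ℕ → M) : Prop :=
  IsNull τ (atTop ×ˢ atTop) (fun p : ℕ × ℕ => x p.1 - x p.2)

protected theorem IsCauchy₂.neg {x : ℕ → M} (hx : IsCauchy₂ τ x) : IsCauchy₂ τ (fun n => -x n) := by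
  have h := IsNull.neg hx
  simpa only [IsCauchy₂, neg_sub, neg_sub_neg] using h

variable [PartialOrder M] [StarOrderedRing M]

theorem IsNull.mul_left (hu : IsNull τ l u) (hτ : IsOneQuasitrace τ) {a : ι → M} {C : ℝ}
    (ha : ∀ i, ‖a i‖ ≤ C) : IsNull τ l (fun i => a i * u i) := by
  refine IsNull.of_le (.of_forall fun i => (hτ.norm₂_mul_le _ _).trans
    (mul_le_mul_of_nonneg_right (ha i) (norm₂_nonneg _ _))) ?_
  simpa using Tendsto.const_mul C hu

theorem IsNull.mul_right (hu : IsNull τ l u) (hτ : IsOneQuasitrace τ) {a : ι → M} {C : ℝ}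
    (ha : ∀ i, ‖a i‖ ≤ C) : IsNull τ l (fun i => u i * a i) := by
  refine IsNull.of_le (.of_forall fun i => (hτ.norm₂_mul_le' _ _).trans
    (mul_le_mul_of_nonneg_left (ha i) (norm₂_nonneg _ _))) ?_
  simpa using Tendsto.mul_const C hu

protected theorem IsNull.add (hu : IsNull τ l u) (hv : IsNull τ l v) (hτ : IsQuasitrace τ) :
    IsNull τ l (fun i => u i + v i) := by
  refine IsNull.of_le (.of_forall fun i => hτ.norm₂_add_le _ _) ?_
  simpa using (Tendsto.add hu hv).const_mul 2

protected theorem IsNull.sub (hu : IsNull τ l u) (hv : IsNull τ l v) (hτ : IsQuasitrace τ) :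
    IsNull τ l (fun i => u i - v i) := by
  simpa only [sub_eq_add_neg] using hu.add hv.neg hτ

/-- The 2-quasinorm is dominated by a multiple of the operator norm, so null families are closed
under uniform norm approximation. -/
theorem IsQuasitrace.isNull_of_approx (hτ : IsQuasitrace τ)
    (h : ∀ ε > 0, ∃ v : ι → M, IsNull τ l v ∧ ∀ i, ‖u i - v i‖ ≤ ε) : IsNull τ l u := by
  have h1 := norm₂_nonneg τ 1
  refine tendsto_order.2 ⟨fun a ha => .of_forall fun i => ha.trans_le (norm₂_nonneg _ _),
    fun a ha => ?_⟩
  have hd : 0 < 4 * (norm₂ τ 1 + 1) := by positivity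
  obtain ⟨v, hv, huv⟩ := h (a / (4 * (norm₂ τ 1 + 1))) (by positivity)
  filter_upwards [(tendsto_order.1 hv).2 (a / 4) (by positivity)] with i hi
  have h2 := hτ.norm₂_add_le (u i - v i) (v i)
  rw [sub_add_cancel] at h2
  have h3 := (hτ.norm₂_le (u i - v i)).trans (mul_le_mul_of_nonneg_right (huv i) h1)
  have h4 : a / (4 * (norm₂ τ 1 + 1)) * norm₂ τ 1 ≤ a / 4 := by
    rw [div_mul_eq_mul_div, div_le_div_iff₀ hd (by norm_num)]
    nlinarith
  linarith

end Null

/-! ### Algebra and functional calculus of bounded Cauchy sequences. -/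

section Cauchy

variable {M : Type*} [CStarAlgebra M] [PartialOrder M] [StarOrderedRing M] {τ : M → ℂ}
  {x y : ℕ → M}

protected theorem IsCauchy₂.add (hx : IsCauchy₂ τ x) (hy : IsCauchy₂ τ y) (hτ : IsQuasitrace τ) :
    IsCauchy₂ τ (fun n => x n + y n) := by
  have h := IsNull.add hx hy hτ
  simpa only [IsCauchy₂, add_sub_add_comm] using h

protected theorem IsCauchy₂.star (hx : IsCauchy₂ τ x) (hτ : IsQuasitrace τ) :
    IsCauchy₂ τ (fun n => star (x n)) := by
  have h := IsNull.star hx hτ.toIsOneQuasitrace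
  simpa only [IsCauchy₂, star_sub] using h

theorem IsQuasitrace.isCauchy₂_const (hτ : IsQuasitrace τ) (z : M) :
    IsCauchy₂ τ (fun _ => z) := by
  simpa only [IsCauchy₂, sub_self] using hτ.isNull_zero

theorem IsNull.isCauchy₂ (hx : IsNull τ atTop x) (hτ : IsQuasitrace τ) : IsCauchy₂ τ x :=
  IsNull.sub (IsNull.comp hx tendsto_fst) (IsNull.comp hx tendsto_snd) hτ

protected theorem IsCauchy₂.mul (hx : IsCauchy₂ τ x) (hy : IsCauchy₂ τ y) (hτ : IsQuasitrace τ) {C D : ℝ}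
    (hC : ∀ n, ‖x n‖ ≤ C) (hD : ∀ n, ‖y n‖ ≤ D) : IsCauchy₂ τ (fun n => x n * y n) := by
  have h := IsNull.add
    (IsNull.mul_right hx hτ.toIsOneQuasitrace (a := fun p : ℕ × ℕ => y p.1) fun p => hD p.1)
    (IsNull.mul_left hy hτ.toIsOneQuasitrace (a := fun p : ℕ × ℕ => x p.2) fun p => hC p.2) hτ
  have e : ∀ p : ℕ × ℕ, (x p.1 - x p.2) * y p.1 + x p.2 * (y p.1 - y p.2) =
      x p.1 * y p.1 - x p.2 * y p.2 := fun p => by noncomm_ring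
  simpa only [IsCauchy₂, e] using h

protected theorem IsCauchy₂.pow (hx : IsCauchy₂ τ x) (hτ : IsQuasitrace τ) {C : ℝ}
    (hC : ∀ n, ‖x n‖ ≤ C) (m : ℕ) :
    IsCauchy₂ τ (fun n => x n ^ m) ∧ ∃ D, ∀ n, ‖x n ^ m‖ ≤ D := by
  induction m with
  | zero => simpa using ⟨hτ.isCauchy₂_const 1, ‖(1 : M)‖, le_rfl⟩
  | succ m ih =>
    obtain ⟨h1, D, hD⟩ := ih
    simp only [pow_succ]
    refine ⟨h1.mul hx hτ hD hC, D * C, fun n => (norm_mul_le _ _).trans ?_⟩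
    exact mul_le_mul (hD n) (hC n) (norm_nonneg _) ((norm_nonneg _).trans (hD n))

protected theorem IsCauchy₂.aeval (hx : IsCauchy₂ τ x) (hτ : IsQuasitrace τ) {C : ℝ}
    (hC : ∀ n, ‖x n‖ ≤ C) (p : Polynomial ℝ) :
    IsCauchy₂ τ (fun n => Polynomial.aeval (x n) p) := by
  induction p using Polynomial.induction_on' with
  | add p q hp hq => simpa only [map_add] using hp.add hq hτ
  | monomial m r =>
    obtain ⟨h1, D, hD⟩ := hx.pow hτ hC m
    simpa only [Polynomial.aeval_monomial] using
      (hτ.isCauchy₂_const (algebraMap ℝ M r)).mul h1 hτ (fun _ => le_rfl) hD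

/-- The continuous functional calculus preserves norm-bounded Cauchy sequences. -/
protected theorem IsCauchy₂.cfc (hx : IsCauchy₂ τ x) (hτ : IsQuasitrace τ) {C : ℝ}
    (hC : ∀ n, ‖x n‖ ≤ C) (hsa : ∀ n, IsSelfAdjoint (x n)) {f : ℝ → ℝ} (hf : Continuous f) :
    IsCauchy₂ τ (fun n => cfc f (x n)) := by
  refine hτ.isNull_of_approx fun ε hε => ?_
  obtain ⟨p, hp⟩ := exists_polynomial_near_of_continuousOn (-C) C f hf.continuousOn (ε / 2)
    (half_pos hε)
  have key : ∀ n, ‖cfc f (x n) - Polynomial.aeval (x n) p‖ ≤ ε / 2 := by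
    intro n
    rcases subsingleton_or_nontrivial M with hM | hM
    · rw [Subsingleton.elim (cfc f (x n) - Polynomial.aeval (x n) p) 0, norm_zero]
      exact (half_pos hε).le
    rw [← cfc_polynomial p (x n) (hsa n), ← cfc_sub f _ (x n) hf.continuousOn
      p.continuous.continuousOn]
    refine norm_cfc_le (half_pos hε).le fun s hs => ?_
    have := (spectrum.norm_le_norm_of_mem hs).trans (hC n)
    rw [Real.norm_eq_abs, abs_sub_comm]
    exact (hp s (abs_le.1 this)).le
  refine ⟨_, hx.aeval hτ hC p, fun q => ?_⟩
  rw [sub_sub_sub_comm]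
  exact (norm_sub_le _ _).trans (by linarith [key q.1, key q.2])

end Cauchy

/-! ### Projections in AW⋆-algebras, and normality. -/

section Projections

variable {M : Type*} [CStarAlgebra M]

theorem IsAWStar.exists_annihilator (h : IsAWStar M) (S : Set M) :
    ∃ p : M, IsStarProjection p ∧ ∀ z, (∀ s ∈ S, s * z = 0) ↔ p * z = z := by
  obtain ⟨p, hp, hS⟩ := h S
  refine ⟨p, hp, fun z => ?_⟩
  have : (∀ s ∈ S, s * z = 0) ↔ z ∈ Set.range fun y : M => p * y := by rw [← hS]; rfl
  rw [this]
  refine ⟨?_, fun hz => ⟨z, hz⟩⟩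
  rintro ⟨y, rfl⟩
  rw [← mul_assoc, hp.isIdempotentElem.eq]

theorem cfc_sub_const_pos_neg {c : M} (hc : IsSelfAdjoint c) (r : ℝ) :
    cfc (fun s => max (s - r) 0) c - cfc (fun s => max (r - s) 0) c = c - algebraMap ℝ M r := by
  rw [← cfc_sub (fun s => max (s - r) 0) (fun s => max (r - s) 0) c (by fun_prop) (by fun_prop)]
  have : ∀ s : ℝ, max (s - r) 0 - max (r - s) 0 = s - r := fun s => by
    rcases le_total s r with h | h
    · rw [max_eq_right (by linarith), max_eq_left (by linarith)]; ring
    · rw [max_eq_left (by linarith), max_eq_right (by linarith)]; ring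
  rw [funext this, cfc_sub (fun s : ℝ => s) (fun _ => r) c continuous_id.continuousOn
    continuous_const.continuousOn, cfc_id' ℝ c, cfc_const _ c]

theorem cfc_pos_mul_cfc_neg (c : M) (r : ℝ) :
    cfc (fun s => max (s - r) 0) c * cfc (fun s => max (r - s) 0) c = 0 := by
  rw [← cfc_mul (fun s => max (s - r) 0) (fun s => max (r - s) 0) c (by fun_prop) (by fun_prop),
    ← cfc_const_zero ℝ c]
  refine cfc_congr fun s _ => ?_
  rcases le_total s r with h | h
  · simp [max_eq_right (sub_nonpos.2 h)]
  · simp [max_eq_right (sub_nonpos.2 h)]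

theorem IsNormal.re_le_of_isLUB [PartialOrder M] {τ : M → ℂ}
    (hn : IsNormal τ) {p : ℕ → {p : M // IsStarProjection p}}
    (hp : ∀ i j, i ≠ j → (p i : M) * (p j : M) = 0) {q : {p : M // IsStarProjection p}}
    (hq : IsLUB (Set.range p) q) {c : ℕ → ℝ} {C : ℝ} (hc0 : ∀ j, 0 ≤ c j)
    (hc : ∀ j, (τ (p j)).re ≤ c j) (hC : HasSum c C) : (τ q).re ≤ C := by
  have h1 : (Set.range p).Pairwise
      (fun p r : {p : M // IsStarProjection p} => (p : M) * (r : M) = 0) := by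
    rintro _ ⟨i, rfl⟩ _ ⟨j, rfl⟩ hij
    exact hp i j fun h => hij (h ▸ rfl)
  have h2 := Complex.hasSum_re (hn _ q h1 hq)
  refine hasSum_le_of_sum_le h2 fun F => ?_
  -- Normality sums over a set of projections, where repetitions in `p` collapse. One index is
  -- chosen for each member.
  choose j hj using fun s : Set.range p => s.2
  have hinj : Function.Injective j := fun s t hst => by
    apply Subtype.ext
    rw [← hj s, ← hj t, hst]
  calc ∑ s ∈ F, (τ ((s : {p : M // IsStarProjection p}) : M)).re
      ≤ ∑ s ∈ F, c (j s) := Finset.sum_le_sum fun s _ => by rw [← hj s]; exact hc _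
    _ = ∑ i ∈ F.map ⟨j, hinj⟩, c i := by rw [Finset.sum_map]; rfl
    _ ≤ C := sum_le_hasSum _ (fun i _ => hc0 i) hC

theorem IsCauchy₂.exists_forall_lt {τ : M → ℂ} {x : ℕ → M} (hx : IsCauchy₂ τ x) {ε : ℝ} (hε : 0 < ε) :
    ∃ N, ∀ m ≥ N, ∀ n ≥ N, norm₂ τ (x m - x n) < ε := by
  have := (tendsto_order.1 hx).2 ε hε
  rw [eventually_prod_iff] at this
  obtain ⟨p, hp, q, hq, h⟩ := this
  obtain ⟨N, hN⟩ := eventually_atTop.1 (hp.and hq)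
  exact ⟨N, fun m hm n hn => h (hN m hm).1 (hN n hn).2⟩

variable [PartialOrder M] [StarOrderedRing M]

/-- Spectral truncation in an AW⋆-algebra, relative to a projection `q`. -/
theorem IsAWStar.exists_truncation (h : IsAWStar M) {q c : M} (hq : IsStarProjection q)
    (hc : 0 ≤ c) (hqc : q * c = c) {r : ℝ} (hr : 0 ≤ r) :
    ∃ g : M, IsStarProjection g ∧ q * g = g ∧ ‖c * g‖ ≤ r ∧ r • (q - g) ≤ c := by
  have hcs := hc.isSelfAdjoint
  have hcq : c * q = c := by
    simpa [hcs.star_eq, hq.isSelfAdjoint.star_eq] using congrArg star hqc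
  set p : M := cfc (fun s => max (s - r) 0) c with hp
  set m : M := cfc (fun s => max (r - s) 0) c with hm
  have hpm : p * m = 0 := cfc_pos_mul_cfc_neg c r
  have hsub : p - m = c - algebraMap ℝ M r := cfc_sub_const_pos_neg hcs r
  have hp0 : 0 ≤ p := cfc_nonneg fun s _ => le_max_right _ _
  have hcomm : ∀ f : ℝ → ℝ, ∀ z : M, Commute c z → Commute (cfc f c) z := fun f z hz =>
    hz.cfc (by rwa [hcs.star_eq]) f
  have hcq' : Commute c q := hcq.trans hqc.symm
  -- `g` is the largest projection under `q` killed by `(c - r)₊`. It plays the role of the spectral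
  -- projection of `c` for `[0, r]` inside `q`.
  obtain ⟨g, hg, hgz⟩ := h.exists_annihilator {p, 1 - q}
  have hgz' : ∀ z, g * z = z ↔ p * z = 0 ∧ q * z = z := fun z => by
    rw [← hgz]
    simp [sub_mul, sub_eq_zero, eq_comm (a := z)]
  obtain ⟨hpg, hqg⟩ := (hgz' g).1 hg.isIdempotentElem.eq
  have hgq : g * q = g := by
    simpa [hg.isSelfAdjoint.star_eq, hq.isSelfAdjoint.star_eq] using congrArg star hqg
  have hmg : m * q = m * g := by
    have h1 : g * (m * q) = m * q := by
      refine (hgz' _).2 ⟨by rw [← mul_assoc, hpm, zero_mul], ?_⟩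
      rw [← mul_assoc, ← (hcomm _ q hcq').eq, mul_assoc, hq.isIdempotentElem.eq]
    have h2 := congrArg star h1
    simp only [star_mul, hm, star_cfc_real, hg.isSelfAdjoint.star_eq,
      hq.isSelfAdjoint.star_eq] at h2
    rw [← hm, ← (hcomm _ q hcq').eq, mul_assoc, hqg] at h2
    exact h2.symm
  have hcg : g * (c * g) = c * g := by
    refine (hgz' _).2 ⟨?_, by rw [← mul_assoc, hqc]⟩
    rw [← mul_assoc, (hcomm _ c (Commute.refl c)).eq, mul_assoc, hpg, mul_zero]
  refine ⟨g, hg, hqg, ?_, ?_⟩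
  · have h1 : c * g = cfc (fun s => min s r) c * g := by
      have h2 : cfc (fun s => min s r) c = c - p := by
        conv_rhs => rw [← cfc_id' ℝ c]
        rw [hp, ← cfc_sub (fun s : ℝ => s) _ c continuous_id.continuousOn (by fun_prop)]
        refine cfc_congr fun s _ => ?_
        rcases le_total s r with h | h
        · rw [min_eq_left h, max_eq_right (by linarith)]; ring
        · rw [min_eq_right h, max_eq_left (by linarith)]; ring
      rw [h2, sub_mul, hpg, sub_zero]
    rw [h1]
    refine (norm_mul_le _ _).trans (mul_le_of_le_one_right (norm_nonneg _) hg.norm_le |>.trans ?_)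
    refine norm_cfc_le hr fun s hs => ?_
    have := spectrum_nonneg_of_nonneg hc hs
    rw [Real.norm_of_nonneg (le_min this hr)]
    exact min_le_right _ _
  · have e : c - r • (q - g) = p * q + g * c * g := by
      have h1 : (p - m) * (q - g) = p * q := by
        simp only [sub_mul, mul_sub, hpg, hmg]; abel
      rw [hsub, sub_mul, mul_sub, hcq, Algebra.algebraMap_eq_smul_one, smul_mul_assoc,
        one_mul] at h1
      rw [← h1, mul_assoc, hcg]; abel
    rw [← sub_nonneg, e]
    refine add_nonneg (Commute.mul_nonneg hp0 hq.nonneg (hcomm _ q hcq')) ?_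
    have := star_left_conjugate_nonneg hc g
    rwa [hg.isSelfAdjoint.star_eq] at this

/-- Every set of projections in an AW⋆-algebra has a supremum. -/
theorem IsAWStar.exists_isLUB (h : IsAWStar M) (S : Set {p : M // IsStarProjection p}) :
    ∃ q : {p : M // IsStarProjection p}, IsLUB S q := by
  obtain ⟨p, hp, hz⟩ := h.exists_annihilator (Subtype.val '' S)
  refine ⟨⟨1 - p, hp.one_sub⟩, fun s hs => ?_, fun u hu => ?_⟩
  · have h1 := (hz p).2 hp.isIdempotentElem.eq s ⟨s, hs, rfl⟩
    change (s : M) ≤ 1 - p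
    rw [s.2.le_iff_mul_eq_left hp.one_sub, mul_sub, h1, mul_one, sub_zero]
  · change 1 - p ≤ (u : M)
    have h1 : p * (1 - (u : M)) = 1 - u := by
      refine (hz _).1 ?_
      rintro _ ⟨s, hs, rfl⟩
      have := (s.2.le_iff_mul_eq_left u.2).1 (hu hs)
      rw [mul_sub, mul_one, this, sub_self]
    have h2 := (u.2.one_sub.le_iff_mul_eq_right hp).2 h1
    exact sub_le_comm.1 h2

end Projections

/-! ### Egorov's theorem. -/

section Egorov

variable {M : Type*} [CStarAlgebra M] [PartialOrder M] [StarOrderedRing M] {τ : M → ℂ}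

/-- Chebyshev's inequality: truncating `(b q)⋆(b q)` at `r²` gives `r² (q - g) ≤ (b q)⋆(b q)`, and
monotonicity bounds `τ (q - g)`. Cutting inside `q` makes iterated cuts decrease, so the removed
pieces are orthogonal and normality can sum them. -/
theorem IsAWStar.exists_cut (h : IsAWStar M) (hτ : IsOneQuasitrace τ) (b : M) {q : M}
    (hq : IsStarProjection q) {r : ℝ} (hr : 0 < r) :
    ∃ g : M, IsStarProjection g ∧ q * g = g ∧ ‖b * g‖ ≤ r ∧
      (τ (q - g)).re ≤ (norm₂ τ b / r) ^ 2 := by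
  have hqs := hq.isSelfAdjoint.star_eq
  obtain ⟨g, hg, hqg, h1, h2⟩ := h.exists_truncation hq (star_mul_self_nonneg (b * q))
    (by rw [star_mul, hqs, ← mul_assoc q (q * star b), ← mul_assoc q q, hq.isIdempotentElem.eq])
    (sq_nonneg r)
  have hgs := hg.isSelfAdjoint.star_eq
  refine ⟨g, hg, hqg, ?_, ?_⟩
  · have e : star (b * g) * (b * g) = g * (star (b * q) * (b * q) * g) := by
      have : star (b * g) * (b * g) = star (b * q * g) * (b * q * g) := by
        rw [mul_assoc b, hqg]
      rw [this, star_mul _ g, hgs]; simp only [mul_assoc]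
    refine (mul_self_le_mul_self_iff (norm_nonneg _) hr.le).2 ?_
    rw [← CStarRing.norm_star_mul_self, e, ← sq]
    exact (norm_mul_le _ _).trans
      ((mul_le_of_le_one_left (norm_nonneg _) hg.norm_le).trans h1)
  · have hqg' : IsStarProjection (q - g) :=
      (hg.le_iff_sub hq).1 ((hg.le_iff_mul_eq_right hq).2 hqg)
    have h3 := hτ.re_mono (smul_nonneg (sq_nonneg r) hqg'.nonneg) h2
    rw [hτ.re_smul hqg'.isSelfAdjoint, ← hτ.norm₂_sq] at h3
    have h4 : norm₂ τ (b * q) ≤ norm₂ τ b :=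
      (hτ.norm₂_mul_le' b q).trans (mul_le_of_le_one_right (norm₂_nonneg _ _) hq.norm_le)
    rw [div_pow, le_div_iff₀ (by positivity), mul_comm]
    exact h3.trans (pow_le_pow_left₀ (norm₂_nonneg _ _) h4 2)

/-- Egorov's theorem, for a sequence of elements that tends rapidly to zero in `2`-quasinorm. -/
theorem IsAWStar.exists_projection_norm_mul_le (h : IsAWStar M) (hτ : IsOneQuasitrace τ)
    (hn : IsNormal τ) (b : ℕ → M) {r c : ℕ → ℝ} {C : ℝ} (hr : ∀ j, 0 < r j)
    (hc : ∀ j, (norm₂ τ (b j) / r j) ^ 2 ≤ c j) (hC : HasSum c C) :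
    ∃ e : M, IsStarProjection e ∧ (τ (1 - e)).re ≤ C ∧ ∀ j, ‖b j * e‖ ≤ r j := by
  choose G hGp hqG hbG hτG using fun (j : ℕ) (q : {p : M // IsStarProjection p}) =>
    h.exists_cut hτ (b j) q.2 (hr j)
  let g : ℕ → {p : M // IsStarProjection p} := fun n =>
    Nat.rec (motive := fun _ => {p : M // IsStarProjection p})
      ⟨1, IsStarProjection.one M⟩ (fun j q => ⟨G j q, hGp j q⟩) n
  have hg0 : (g 0 : M) = 1 := rfl
  have hgs : ∀ j, (g (j + 1) : M) = G j (g j) := fun j => rfl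
  have hle : ∀ j, (g (j + 1) : M) ≤ g j := fun j =>
    ((g (j + 1)).2.le_iff_mul_eq_right (g j).2).2 (hqG j (g j))
  have hanti : Antitone fun j => (g j : M) := antitone_nat_of_succ_le hle
  have hmul : ∀ i j, i ≤ j → (g i : M) * g j = g j := fun i j hij =>
    ((g j).2.le_iff_mul_eq_right (g i).2).1 (hanti hij)
  have hmul' : ∀ i j, i ≤ j → (g j : M) * g i = g j := fun i j hij =>
    ((g j).2.le_iff_mul_eq_left (g i).2).1 (hanti hij)
  let p : ℕ → {p : M // IsStarProjection p} := fun j =>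
    ⟨g j - g (j + 1), ((g (j + 1)).2.le_iff_sub (g j).2).1 (hle j)⟩
  have hpval : ∀ j, (p j : M) = g j - g (j + 1) := fun j => rfl
  have horth : ∀ i j, i ≠ j → (p i : M) * p j = 0 := by
    intro i j hij
    simp only [hpval, sub_mul, mul_sub]
    rcases hij.lt_or_gt with hij | hij
    · rw [hmul i j hij.le, hmul i (j + 1) (by omega), hmul (i + 1) j hij,
        hmul (i + 1) (j + 1) (by omega)]; abel
    · rw [hmul' j i hij.le, hmul' (j + 1) i hij, hmul' j (i + 1) (by omega),
        hmul' (j + 1) (i + 1) (by omega)]; abel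
  obtain ⟨q, hq⟩ := h.exists_isLUB (Set.range p)
  refine ⟨1 - q, q.2.one_sub, ?_, fun j => ?_⟩
  · rw [sub_sub_cancel]
    exact hn.re_le_of_isLUB horth hq (fun j => (sq_nonneg _).trans (hc j))
      (fun j => (hτG j (g j)).trans (hc j)) hC
  · have h0 : ∀ i, (p i : M) * (1 - q) = 0 := fun i => by
      rw [mul_sub, mul_one, ((p i).2.le_iff_mul_eq_left q.2).1 (hq.1 ⟨i, rfl⟩), sub_self]
    have h1 : ∀ i, (g i : M) * (1 - q) = 1 - q := by
      intro i
      induction i with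
      | zero => rw [hg0, one_mul]
      | succ i ih =>
        have := h0 i
        rw [hpval, sub_mul, ih, sub_eq_zero] at this
        exact this.symm
    rw [← h1 (j + 1), ← mul_assoc]
    exact (norm_mul_le _ _).trans
      ((mul_le_of_le_one_right (norm_nonneg _) q.2.one_sub.norm_le).trans (hbG j (g j)))

/-- Egorov's theorem for Cauchy sequences. -/
theorem IsCauchy₂.exists_projection (h : IsAWStar M) (hτ : IsQuasitrace τ)
    (hn : IsNormal τ) {x : ℕ → M} (hx : IsCauchy₂ τ x) {ε : ℝ} (hε : 0 < ε) :
    ∃ e : M, IsStarProjection e ∧ (τ (1 - e)).re ≤ ε ∧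
      ∃ y, IsNull τ atTop (fun n => x n * e - y) := by
  -- Dividing by the norm bound `(1/2)^j` and squaring leaves `ε / 2^(j+1)`, which sums to `ε`.
  have hη : ∀ j : ℕ, 0 < √(ε / 2 / 2 ^ j) * (1 / 2) ^ j := fun j => by positivity
  choose N hN using fun j => hx.exists_forall_lt (hη j)
  let φ : ℕ → ℕ := fun j => (Finset.range (j + 1)).sup N
  have hφN : ∀ j, N j ≤ φ j := fun j => Finset.le_sup (Finset.self_mem_range_succ j)
  have hφ : ∀ j, φ j ≤ φ (j + 1) := fun j =>
    Finset.sup_mono (Finset.range_subset_range.2 (by omega))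
  obtain ⟨e, he, hτe, hb⟩ := h.exists_projection_norm_mul_le hτ.toIsOneQuasitrace hn
    (fun j => x (φ j) - x (φ (j + 1))) (r := fun j => (1 / 2) ^ j) (c := fun j => ε / 2 / 2 ^ j)
    (fun j => by positivity) (fun j => by
      have h1 := (hN j (φ j) (hφN j) (φ (j + 1)) ((hφN j).trans (hφ j))).le
      have h2 : norm₂ τ (x (φ j) - x (φ (j + 1))) / (1 / 2) ^ j ≤ √(ε / 2 / 2 ^ j) := by
        rwa [div_le_iff₀ (by positivity)]
      refine (pow_le_pow_left₀ (div_nonneg (norm₂_nonneg _ _) (by positivity)) h2 2).trans ?_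
      rw [Real.sq_sqrt (by positivity)]) (hasSum_geometric_two' ε)
  refine ⟨e, he, hτe, ?_⟩
  have hcau : CauchySeq fun j => x (φ j) * e := by
    refine cauchySeq_of_le_geometric (1 / 2) 1 (by norm_num) fun j => ?_
    rw [dist_eq_norm, ← sub_mul, one_mul]
    exact hb j
  obtain ⟨y, hy⟩ := cauchySeq_tendsto_of_complete hcau
  refine ⟨y, ?_⟩
  refine tendsto_order.2 ⟨fun a ha => .of_forall fun i => ha.trans_le (norm₂_nonneg _ _),
    fun a ha => ?_⟩
  have hy' : Tendsto (fun j => ‖x (φ j) * e - y‖ * norm₂ τ 1) atTop (𝓝 0) := by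
    simpa using (tendsto_iff_norm_sub_tendsto_zero.1 hy).mul_const (norm₂ τ 1)
  have hη0 : Tendsto (fun j : ℕ => √(ε / 2 / 2 ^ j) * (1 / 2) ^ j) atTop (𝓝 0) := by
    have h1 : Tendsto (fun j : ℕ => √(ε / 2 / 2 ^ j)) atTop (𝓝 (√0)) :=
      (Real.continuous_sqrt.tendsto 0).comp (hasSum_geometric_two' ε).summable.tendsto_atTop_zero
    simpa using h1.mul (tendsto_pow_atTop_nhds_zero_of_lt_one
      (by norm_num : (0 : ℝ) ≤ 1 / 2) (by norm_num))
  obtain ⟨j, hj1, hj2⟩ := (((tendsto_order.1 hy').2 (a / 4) (by positivity)).and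
    ((tendsto_order.1 hη0).2 (a / 4) (by positivity))).exists
  filter_upwards [eventually_ge_atTop (φ j)] with k hk
  have h1 := hN j k ((hφN j).trans hk) (φ j) (hφN j)
  have h2 : norm₂ τ ((x k - x (φ j)) * e) ≤ norm₂ τ (x k - x (φ j)) :=
    (hτ.norm₂_mul_le' _ _).trans (mul_le_of_le_one_right (norm₂_nonneg _ _) he.norm_le)
  have h3 := hτ.norm₂_le (x (φ j) * e - y)
  have h4 := hτ.norm₂_add_le ((x k - x (φ j)) * e) (x (φ j) * e - y)
  rw [sub_mul, sub_add_sub_cancel] at h4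
  rw [sub_mul] at h2
  linarith

end Egorov

/-! ### Separation, binary digits and existence of limits. -/

section Bisection

variable {M : Type*} [CStarAlgebra M] [PartialOrder M] [StarOrderedRing M] {τ : M → ℂ}

/-- Split `w n = w n r + w n (1 - r)`. The second term has 2-quasinorm at most `C τ(1 - r)^(1/2)`,
uniformly in `n`. -/
theorem IsQuasitrace.isNull_of_forall_projection (hτ : IsQuasitrace τ) {w : ℕ → M} {C : ℝ}
    (hC : ∀ n, ‖w n‖ ≤ C)
    (h : ∀ ε > 0, ∃ r : M, IsStarProjection r ∧ (τ (1 - r)).re ≤ ε ∧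
      IsNull τ atTop (fun n => w n * r)) : IsNull τ atTop w := by
  have hC0 : 0 ≤ C := (norm_nonneg _).trans (hC 0)
  refine tendsto_order.2 ⟨fun a ha => .of_forall fun i => ha.trans_le (norm₂_nonneg _ _),
    fun a ha => ?_⟩
  obtain ⟨r, hr, hτr, hw⟩ := h ((a / (4 * (C + 1))) ^ 2) (by positivity)
  have hr1 : norm₂ τ (1 - r) ≤ a / (4 * (C + 1)) := by
    rw [norm₂, hr.one_sub.isSelfAdjoint.star_eq, hr.one_sub.isIdempotentElem.eq]
    exact (Real.sqrt_le_left (by positivity)).2 hτr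
  filter_upwards [(tendsto_order.1 hw).2 (a / 4) (by positivity)] with n hn
  have h1 : norm₂ τ (w n * (1 - r)) ≤ a / 4 := by
    calc norm₂ τ (w n * (1 - r)) ≤ ‖w n‖ * norm₂ τ (1 - r) := hτ.norm₂_mul_le _ _
      _ ≤ C * (a / (4 * (C + 1))) :=
        mul_le_mul (hC n) hr1 (norm₂_nonneg _ _) hC0
      _ ≤ a / 4 := by
        rw [mul_div_assoc', div_le_div_iff₀ (by positivity) (by norm_num)]
        nlinarith
  have h2 := hτ.norm₂_add_le (w n * r) (w n * (1 - r))
  rw [← mul_add, add_sub_cancel, mul_one] at h2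
  linarith

/-- Two bounded Cauchy sequences with vanishing products are asymptotically supported under
complementary projections. -/
theorem IsCauchy₂.exists_separating_projection (h : IsAWStar M) (hτ : IsQuasitrace τ)
    (hf : IsFaithful τ) (hn : IsNormal τ) {u v : ℕ → M} (hu : IsCauchy₂ τ u)
    (hv : IsCauchy₂ τ v) (husa : ∀ n, star (u n) = u n) {C : ℝ}
    (huC : ∀ n, ‖u n‖ ≤ C) (hvC : ∀ n, ‖v n‖ ≤ C) (huv : ∀ n, u n * v n = 0) :
    ∃ e : M, IsStarProjection e ∧ IsNull τ atTop (fun n => (1 - e) * u n) ∧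
      IsNull τ atTop (fun n => e * v n) := by
  have h1 := hτ.toIsOneQuasitrace
  -- The set consists of adjoints of all local limits of `u`, so `p` kills the limits `y` of `u n r`
  -- from the left. If `v n r` tends to `y`, then `s y` is the limit of `(u n r')⋆(v n r) = 0`,
  -- hence `p y = y`.
  obtain ⟨p, hp, hz⟩ := h.exists_annihilator
    {s | ∃ r : M, IsStarProjection r ∧ IsNull τ atTop (fun n => u n * r - star s)}
  have hmulC : ∀ {q : M}, IsStarProjection q → ∀ w : ℕ → M, (∀ n, ‖w n‖ ≤ C) →
      ∀ n, ‖q * w n‖ ≤ C := fun hq w hw n => (norm_mul_le _ _).trans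
    ((mul_le_of_le_one_left (norm_nonneg _) hq.norm_le).trans (hw n))
  refine ⟨1 - p, hp.one_sub, ?_, ?_⟩
  · simp only [sub_sub_cancel]
    refine hτ.isNull_of_forall_projection (hmulC hp u huC) fun ε hε => ?_
    obtain ⟨r, hr, hτr, y, hy⟩ := hu.exists_projection h hτ hn hε
    refine ⟨r, hr, hτr, ?_⟩
    have hyp : star y * p = 0 := (hz p).2 hp.isIdempotentElem.eq (star y)
      ⟨r, hr, by simpa only [star_star] using hy⟩
    have hpy : p * y = 0 := by
      simpa [hp.isSelfAdjoint.star_eq] using congrArg star hyp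
    have h2 := hy.mul_left h1 (a := fun _ => p) fun _ => le_rfl
    simpa only [mul_sub, hpy, sub_zero, mul_assoc] using h2
  · refine hτ.isNull_of_forall_projection (hmulC hp.one_sub v hvC) fun ε hε => ?_
    obtain ⟨r, hr, hτr, y, hy⟩ := hv.exists_projection h hτ hn hε
    refine ⟨r, hr, hτr, ?_⟩
    have hpy : p * y = y := by
      refine (hz y).1 ?_
      rintro s ⟨r', hr', hs⟩
      refine IsNull.eq_zero (l := atTop (α := ℕ)) ?_ h1 hf
      have h2 := hy.mul_left h1 (a := fun _ => s) fun _ => le_rfl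
      have h3 := (hs.star h1).mul_right h1 (a := fun n => v n * r) (C := C) fun n =>
        (norm_mul_le _ _).trans ((mul_le_of_le_one_right (norm_nonneg _) hr.norm_le).trans (hvC n))
      have h4 := (h2.add h3 hτ).neg
      have e : ∀ n, -(s * (v n * r - y) + star (u n * r' - star s) * (v n * r)) = s * y := by
        intro n
        have h5 : star (u n * r') * (v n * r) = 0 := by
          rw [star_mul, husa, mul_assoc, ← mul_assoc (u n), huv, zero_mul, mul_zero]
        rw [star_sub, star_star, sub_mul, h5]
        noncomm_ring
      simpa only [e] using h4
    have h2 := hy.mul_left h1 (a := fun _ => 1 - p) fun _ => le_rfl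
    have h3 : (1 - p) * y = 0 := by rw [sub_mul, one_mul, hpy, sub_self]
    simpa only [mul_sub (1 - p), h3, sub_zero, mul_assoc] using h2

/-- One binary digit: a Cauchy sequence in the unit interval of `M` is asymptotic to
`(e + x') / 2` for a projection `e` and another such sequence `x'`. -/
theorem IsCauchy₂.exists_bisection (h : IsAWStar M) (hτ : IsQuasitrace τ)
    (hf : IsFaithful τ) (hn : IsNormal τ) {x : ℕ → M} (hx : IsCauchy₂ τ x)
    (hx0 : ∀ n, 0 ≤ x n) (hx1 : ∀ n, x n ≤ 1) :
    ∃ e : M, IsStarProjection e ∧ ∃ x' : ℕ → M, IsCauchy₂ τ x' ∧ (∀ n, 0 ≤ x' n) ∧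
      (∀ n, x' n ≤ 1) ∧ IsNull τ atTop (fun n => x n - (1 / 2 : ℝ) • (e + x' n)) := by
  have h1 := hτ.toIsOneQuasitrace
  have hsa : ∀ n, IsSelfAdjoint (x n) := fun n => (hx0 n).isSelfAdjoint
  have hxn : ∀ n, ‖x n‖ ≤ 1 := fun n => (CStarAlgebra.norm_le_one_iff_of_nonneg _ (hx0 n)).2 (hx1 n)
  have hspec : ∀ n, ∀ s ∈ spectrum ℝ (x n), 0 ≤ s ∧ s ≤ 1 := fun n s hs =>
    ⟨spectrum_nonneg_of_nonneg (hx0 n) hs,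
      (le_algebraMap_iff_spectrum_le (r := (1 : ℝ)) (hsa n)).1 (by simpa using hx1 n) s hs⟩
  let u : ℕ → M := fun n => cfc (fun s : ℝ => max (s - 1 / 2) 0) (x n)
  let v : ℕ → M := fun n => cfc (fun s : ℝ => max (1 / 2 - s) 0) (x n)
  have hu : IsCauchy₂ τ u := hx.cfc hτ hxn hsa (by fun_prop)
  have hv : IsCauchy₂ τ v := hx.cfc hτ hxn hsa (by fun_prop)
  have hbound : ∀ f : ℝ → ℝ, (∀ s, 0 ≤ s → s ≤ 1 → 0 ≤ f s ∧ f s ≤ 1 / 2) → Continuous f →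
      ∀ n, 0 ≤ cfc f (x n) ∧ cfc f (x n) ≤ (1 / 2 : ℝ) • 1 := by
    intro f hf hfc n
    refine ⟨cfc_nonneg fun s hs => (hf s (hspec n s hs).1 (hspec n s hs).2).1, ?_⟩
    rw [← Algebra.algebraMap_eq_smul_one]
    exact cfc_le_algebraMap _ _ _ (fun s hs => (hf s (hspec n s hs).1 (hspec n s hs).2).2)
      hfc.continuousOn (hsa n)
  have hub := hbound (fun s => max (s - 1 / 2) 0)
    (fun s _ h1 => ⟨le_max_right _ _, max_le (by linarith) (by norm_num)⟩) (by fun_prop)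
  have hvb := hbound (fun s => max (1 / 2 - s) 0)
    (fun s h0 _ => ⟨le_max_right _ _, max_le (by linarith) (by norm_num)⟩) (by fun_prop)
  have hhalf : (1 / 2 : ℝ) • (1 : M) ≤ 1 := by
    have : (1 / 2 : ℝ) • (1 : M) ≤ (1 : ℝ) • 1 :=
      smul_le_smul_of_nonneg_right (by norm_num) zero_le_one
    simpa using this
  have hun : ∀ n, ‖u n‖ ≤ 1 := fun n =>
    (CStarAlgebra.norm_le_one_iff_of_nonneg _ (hub n).1).2 ((hub n).2.trans hhalf)
  have hvn : ∀ n, ‖v n‖ ≤ 1 := fun n =>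
    (CStarAlgebra.norm_le_one_iff_of_nonneg _ (hvb n).1).2 ((hvb n).2.trans hhalf)
  have husa : ∀ n, star (u n) = u n := fun n => star_cfc_real _ _
  have hvsa : ∀ n, star (v n) = v n := fun n => star_cfc_real _ _
  obtain ⟨e, he, heu, hev⟩ := hu.exists_separating_projection h hτ hf hn hv husa hun hvn
    fun n => cfc_pos_mul_cfc_neg (x n) (1 / 2)
  have hes := he.isSelfAdjoint.star_eq
  have hes' := he.one_sub.isSelfAdjoint.star_eq
  have hee := he.isIdempotentElem.eq
  have hxuv : ∀ n, x n = u n - v n + (1 / 2 : ℝ) • 1 := fun n => by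
    have := cfc_sub_const_pos_neg (hsa n) (1 / 2)
    rw [Algebra.algebraMap_eq_smul_one] at this
    simp only [u, v, this, sub_add_cancel]
  -- Since `u` is asymptotically `e u e` and `v` is `(1 - e) v (1 - e)`, the identity `x = u - v +
  -- 1/2` becomes `x ~ e/2 + w`. Compressing by `e` and `1 - e` keeps `0 ≤ w ≤ 1/2` exactly, so `2
  -- w` can be bisected again.
  let w : ℕ → M := fun n => e * u n * e + (1 - e) * ((1 / 2 : ℝ) • 1 - v n) * (1 - e)
  have hw0 : ∀ n, 0 ≤ w n := fun n => add_nonneg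
    (by have := star_left_conjugate_nonneg (hub n).1 e; rwa [hes] at this)
    (by have := star_left_conjugate_nonneg (sub_nonneg.2 (hvb n).2) (1 - e); rwa [hes'] at this)
  have hw1 : ∀ n, w n ≤ (1 / 2 : ℝ) • 1 := fun n => by
    have a1 := star_left_conjugate_le_conjugate (hub n).2 e
    have a2 := star_left_conjugate_le_conjugate (sub_le_self ((1 / 2 : ℝ) • 1) (hvb n).1) (1 - e)
    rw [hes] at a1
    rw [hes'] at a2
    refine (add_le_add a1 a2).trans_eq ?_
    simp only [mul_smul_comm, mul_one, smul_mul_assoc, hee, he.one_sub.isIdempotentElem.eq,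
      ← smul_add, add_sub_cancel]
  have hnull : IsNull τ atTop (fun n => x n - ((1 / 2 : ℝ) • e + w n)) := by
    have b1 := heu.add ((heu.star h1).mul_left h1 (a := fun _ => e) fun _ => le_rfl) hτ
    have b2 := hev.add ((hev.star h1).mul_left h1 (a := fun _ => 1 - e) fun _ => le_rfl) hτ
    have b3 := b1.sub b2 hτ
    refine Eq.mp (congrArg _ (funext fun n => ?_)) b3
    simp only [star_mul, hes, hes', husa, hvsa, w]
    rw [hxuv n]
    have c1 : (1 - e) * ((1 / 2 : ℝ) • 1 - v n) * (1 - e) =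
        (1 / 2 : ℝ) • (1 - e) - (1 - e) * v n * (1 - e) := by
      rw [mul_sub (1 - e) _ (v n), sub_mul _ ((1 - e) * v n), mul_smul_comm, mul_one, smul_mul_assoc,
        he.one_sub.isIdempotentElem.eq]
    rw [c1, smul_sub]
    noncomm_ring
  have hhh : ∀ n, (1 / 2 : ℝ) • (e + (2 : ℝ) • w n) = (1 / 2 : ℝ) • e + w n := fun n => by
    rw [smul_add, smul_smul]; norm_num
  refine ⟨e, he, fun n => (2 : ℝ) • w n, ?_, fun n => smul_nonneg (by norm_num) (hw0 n),
    fun n => ?_, ?_⟩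
  · have c1 := (hx.add ((hnull.isCauchy₂ hτ).neg.add
      (hτ.isCauchy₂_const (-((1 / 2 : ℝ) • e))) hτ) hτ)
    have c2 := c1.add c1 hτ
    have e1 : ∀ n, x n + (-(x n - ((1 / 2 : ℝ) • e + w n)) + -((1 / 2 : ℝ) • e)) = w n :=
      fun n => by abel
    simp only [e1] at c2
    simpa only [two_smul] using c2
  · have := smul_le_smul_of_nonneg_left (hw1 n) (by norm_num : (0 : ℝ) ≤ 2)
    rw [smul_smul] at this
    norm_num at this
    exact this
  · simpa only [hhh] using hnull

/-- After `J` bisections, `x n` is asymptotic to a partial sum of `∑ 2^(-j-1) e_j` plus a remainder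
of operator norm at most `2^(-J)`. The series converges in norm, and its sum is the limit. -/
theorem IsCauchy₂.exists_limit_of_mem_Icc (h : IsAWStar M) (hτ : IsQuasitrace τ)
    (hf : IsFaithful τ) (hn : IsNormal τ) {x : ℕ → M} (hx : IsCauchy₂ τ x)
    (hx0 : ∀ n, 0 ≤ x n) (hx1 : ∀ n, x n ≤ 1) :
    ∃ a : M, IsNull τ atTop (fun n => x n - a) := by
  have h1 := hτ.toIsOneQuasitrace
  let Q : Type _ := {x : ℕ → M // IsCauchy₂ τ x ∧ (∀ n, 0 ≤ x n) ∧ ∀ n, x n ≤ 1}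
  have hstep : ∀ y : Q, ∃ (e : M) (y' : Q), ‖e‖ ≤ 1 ∧
      IsNull τ atTop (fun n => y.1 n - (1 / 2 : ℝ) • (e + y'.1 n)) := by
    rintro ⟨y, hy, hy0, hy1⟩
    obtain ⟨e, he, y', h2, h3, h4, h5⟩ := hy.exists_bisection h hτ hf hn hy0 hy1
    exact ⟨e, ⟨y', h2, h3, h4⟩, he.norm_le, h5⟩
  choose E Y hE hY using hstep
  let X : ℕ → Q := fun j => Y^[j] ⟨x, hx, hx0, hx1⟩
  have hXs : ∀ j, X (j + 1) = Y (X j) := fun j => Function.iterate_succ_apply' _ _ _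
  let t : ℕ → M := fun j => ((1 / 2 : ℝ) ^ (j + 1)) • E (X j)
  have hpart : ∀ J, IsNull τ atTop (fun n => x n - (∑ j ∈ Finset.range J, t j +
      ((1 / 2 : ℝ) ^ J) • (X J).1 n)) := by
    intro J
    induction J with
    | zero => simpa [X] using h1.isNull_zero
    | succ J ih =>
      have h2 := (hY (X J)).mul_left h1 (a := fun _ => ((1 / 2 : ℝ) ^ J) • (1 : M))
        fun _ => le_rfl
      refine Eq.mp (congrArg _ (funext fun n => ?_)) (ih.add h2 hτ)
      rw [Finset.sum_range_succ, hXs]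
      simp only [t, smul_mul_assoc, one_mul, smul_sub, smul_add, smul_smul, pow_succ]
      abel
  have hsum : Summable t := by
    refine Summable.of_norm_bounded (g := fun j : ℕ => (1 / 2 : ℝ) ^ (j + 1)) ?_ fun j => ?_
    · exact (summable_nat_add_iff 1).2 (summable_geometric_of_lt_one (by norm_num) (by norm_num))
    · rw [norm_smul, Real.norm_of_nonneg (by positivity)]
      exact mul_le_of_le_one_right (by positivity) (hE _)
  refine ⟨∑' j, t j, hτ.isNull_of_approx fun ε hε => ?_⟩
  have hlim : Tendsto (fun J => ‖∑ j ∈ Finset.range J, t j - ∑' j, t j‖ + (1 / 2 : ℝ) ^ J)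
      atTop (𝓝 0) := by
    simpa using (tendsto_iff_norm_sub_tendsto_zero.1 hsum.hasSum.tendsto_sum_nat).add
      (tendsto_pow_atTop_nhds_zero_of_lt_one (by norm_num : (0 : ℝ) ≤ 1 / 2) (by norm_num))
  obtain ⟨J, hJ⟩ := ((tendsto_order.1 hlim).2 ε hε).exists
  refine ⟨_, hpart J, fun n => le_trans ?_ hJ.le⟩
  have e1 : x n - ∑' j, t j - (x n - (∑ j ∈ Finset.range J, t j +
      ((1 / 2 : ℝ) ^ J) • (X J).1 n)) =
      (∑ j ∈ Finset.range J, t j - ∑' j, t j) + ((1 / 2 : ℝ) ^ J) • (X J).1 n := by abel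
  rw [e1]
  refine (norm_add_le _ _).trans (add_le_add le_rfl ?_)
  rw [norm_smul, Real.norm_of_nonneg (by positivity)]
  exact mul_le_of_le_one_right (by positivity)
    ((CStarAlgebra.norm_le_one_iff_of_nonneg _ ((X J).2.2.1 n)).2 ((X J).2.2.2 n))

theorem IsCauchy₂.exists_limit_add_star (h : IsAWStar M) (hτ : IsQuasitrace τ)
    (hf : IsFaithful τ) (hn : IsNormal τ) {x : ℕ → M} (hx : IsCauchy₂ τ x)
    (hx1 : ∀ n, ‖x n‖ ≤ 1) :
    ∃ a : M, IsNull τ atTop (fun n => (x n + star (x n)) - a) := by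
  have h1 := hτ.toIsOneQuasitrace
  let q : M := (1 / 4 : ℝ) • 1
  -- An affine change carries `-2 ≤ x + x⋆ ≤ 2` into `[0, 1]`.
  have hy : IsCauchy₂ τ (fun n => q * (x n + star (x n)) + (1 / 2 : ℝ) • 1) :=
    ((hτ.isCauchy₂_const q).mul (hx.add (hx.star hτ) hτ) hτ (fun _ => le_rfl) (D := 2)
      fun n => (norm_add_le _ _).trans (by rw [norm_star]; linarith [hx1 n])).add
      (hτ.isCauchy₂_const _) hτ
  have hb : ∀ n, -algebraMap ℝ M 2 ≤ x n + star (x n) ∧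
      x n + star (x n) ≤ algebraMap ℝ M 2 := fun n => by
    have hs : IsSelfAdjoint (x n + star (x n)) := .add_star_self (x n)
    have hn2 : ‖x n + star (x n)‖ ≤ 2 :=
      (norm_add_le _ _).trans (by rw [norm_star]; linarith [hx1 n])
    have hm : algebraMap ℝ M ‖x n + star (x n)‖ ≤ algebraMap ℝ M 2 := algebraMap_mono M hn2
    exact ⟨(neg_le_neg hm).trans hs.neg_algebraMap_norm_le_self,
      hs.le_algebraMap_norm_self.trans hm⟩
  have hq : ∀ z : M, q * z = (1 / 4 : ℝ) • z := fun z => by simp [q]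
  have hquarter : (1 / 4 : ℝ) • algebraMap ℝ M 2 = (1 / 2 : ℝ) • 1 := by
    rw [Algebra.algebraMap_eq_smul_one, smul_smul]; norm_num
  have hhalf : (1 / 2 : ℝ) • (1 : M) + (1 / 2 : ℝ) • (1 : M) = 1 := by
    rw [← add_smul]; norm_num
  obtain ⟨a, ha⟩ := hy.exists_limit_of_mem_Icc h hτ hf hn
    (fun n => by
      have := smul_le_smul_of_nonneg_left (hb n).1 (by norm_num : (0 : ℝ) ≤ 1 / 4)
      rw [smul_neg, hquarter, neg_le_iff_add_nonneg] at this
      rwa [hq])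
    (fun n => by
      have := smul_le_smul_of_nonneg_left (hb n).2 (by norm_num : (0 : ℝ) ≤ 1 / 4)
      rw [hquarter] at this
      rw [hq]
      exact (add_le_add_left this _).trans_eq hhalf)
  refine ⟨(4 : ℝ) • (a - (1 / 2 : ℝ) • 1), ?_⟩
  have h2 := ha.mul_left h1 (a := fun _ => (4 : ℝ) • (1 : M)) fun _ => le_rfl
  refine Eq.mp (congrArg _ (funext fun n => ?_)) h2
  simp only [hq, smul_mul_assoc, one_mul, smul_sub, smul_add, smul_smul]
  norm_num
  abel

/-- Apply the self-adjoint case to `x` and to `i x`, and use `2 x = (x + x⋆) - i (i x + (i x)⋆)`. -/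
theorem IsCauchy₂.exists_limit (h : IsAWStar M) (hτ : IsQuasitrace τ)
    (hf : IsFaithful τ) (hn : IsNormal τ) {x : ℕ → M} (hx : IsCauchy₂ τ x)
    (hx1 : ∀ n, ‖x n‖ ≤ 1) : ∃ a : M, IsNull τ atTop (fun n => x n - a) := by
  have h1 := hτ.toIsOneQuasitrace
  obtain ⟨a, ha⟩ := hx.exists_limit_add_star h hτ hf hn hx1
  have hy : IsCauchy₂ τ (fun n => (Complex.I • 1 : M) * x n) :=
    (hτ.isCauchy₂_const _).mul hx hτ (fun _ => le_rfl) hx1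
  obtain ⟨b, hb⟩ := hy.exists_limit_add_star h hτ hf hn fun n => by
    rw [smul_mul_assoc, one_mul, norm_smul, Complex.norm_I, one_mul]; exact hx1 n
  have h2 := (ha.add (hb.mul_left h1 (a := fun _ => (-Complex.I • 1 : M)) fun _ => le_rfl)
    hτ).mul_left h1 (a := fun _ => ((1 / 2 : ℂ) • 1 : M)) fun _ => le_rfl
  refine ⟨(1 / 2 : ℂ) • (a + -Complex.I • b), ?_⟩
  refine Eq.mp (congrArg _ (funext fun n => ?_)) h2
  simp only [smul_mul_assoc, one_mul, star_smul, smul_sub, smul_add, smul_smul]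
  have hI : -Complex.I * Complex.I = 1 := by simp
  have hI' : -Complex.I * star Complex.I = -1 := by simp
  rw [hI, hI']
  have : x n = (1 / 2 : ℂ) • x n + (1 / 2 : ℂ) • x n := by rw [← add_smul]; norm_num
  conv_rhs => rw [this]
  simp only [mul_one, mul_neg, neg_smul]
  abel

/-- The closed unit ball is closed under limits in `2`-quasinorm. -/
theorem IsNull.norm_limit_le_one (h : IsAWStar M) (hτ : IsQuasitrace τ)
    (hf : IsFaithful τ) {x : ℕ → M} (hx1 : ∀ n, ‖x n‖ ≤ 1) {a : M}
    (ha : IsNull τ atTop (fun n => x n - a)) : ‖a‖ ≤ 1 := by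
  have h1 := hτ.toIsOneQuasitrace
  have key : ∀ r : ℝ, 1 < r → ‖a‖ * ‖a‖ ≤ r := by
    intro r hr
    obtain ⟨g, hg, -, hcg, hle⟩ := h.exists_truncation (.one M) (star_mul_self_nonneg a)
      (one_mul _) (zero_le_one.trans hr.le)
    set e := 1 - g with he
    have hep : IsStarProjection e := hg.one_sub
    have hes := hep.isSelfAdjoint.star_eq
    have hee := hep.isIdempotentElem.eq
    -- `e` is the part of the unit where `a⋆a ≥ r > 1`. Together with `‖a e‖₂ ≤ ‖e‖₂` below, this
    -- forces `e = 0`.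
    have h2 : r * norm₂ τ e ^ 2 ≤ norm₂ τ (a * e) ^ 2 := by
      have h3 := star_left_conjugate_le_conjugate hle e
      rw [hes, mul_smul_comm, hee, smul_mul_assoc, hee] at h3
      have h4 := h1.re_mono (smul_nonneg (zero_le_one.trans hr.le) hep.nonneg) h3
      rw [h1.re_smul hep.isSelfAdjoint] at h4
      rw [h1.norm₂_sq, h1.norm₂_sq, hes, hee, star_mul, hes]
      simpa only [mul_assoc] using h4
    have h3 : norm₂ τ (a * e) ≤ norm₂ τ e := by
      -- The exponent `2/3` gives a triangle inequality with constant `1`. The factor `2` in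
      -- `norm₂_add_le` would be too weak as `r` tends to `1`.
      rw [← Real.rpow_le_rpow_iff (norm₂_nonneg _ _) (norm₂_nonneg _ _)
        (by norm_num : (0 : ℝ) < 2 / 3)]
      have h4 : IsNull τ atTop (fun n => (x n - a) * e) :=
        ha.mul_right h1 (a := fun _ => e) fun _ => le_rfl
      have h5 : Tendsto (fun n => norm₂ τ ((x n - a) * e) ^ (2 / 3 : ℝ) +
          norm₂ τ e ^ (2 / 3 : ℝ)) atTop (𝓝 (norm₂ τ e ^ (2 / 3 : ℝ))) := by
        have := (Tendsto.rpow_const h4 (p := 2 / 3) (Or.inr (by norm_num))).add_const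
          (norm₂ τ e ^ (2 / 3 : ℝ))
        rwa [Real.zero_rpow (by norm_num), zero_add] at this
      refine ge_of_tendsto' h5 fun n => ?_
      have h6 := hτ.norm₂_add_rpow_le hf (-((x n - a) * e)) (x n * e)
      have h7 : -((x n - a) * e) + x n * e = a * e := by noncomm_ring
      rw [h7, norm₂_neg] at h6
      refine h6.trans (add_le_add le_rfl (Real.rpow_le_rpow (norm₂_nonneg _ _) ?_ (by norm_num)))
      exact (h1.norm₂_mul_le _ _).trans (mul_le_of_le_one_left (norm₂_nonneg _ _) (hx1 n))
    have h4 : norm₂ τ e = 0 := by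
      have h5 := norm₂_nonneg τ e
      have h6 := pow_le_pow_left₀ (norm₂_nonneg _ _) h3 2
      have h7 : norm₂ τ e ^ 2 = 0 := le_antisymm (by nlinarith) (sq_nonneg _)
      exact pow_eq_zero_iff two_ne_zero |>.1 h7
    have h5 : g = 1 := (sub_eq_zero.1 ((h1.norm₂_eq_zero hf).1 h4)).symm
    rwa [h5, mul_one, CStarRing.norm_star_mul_self] at hcg
  have : ‖a‖ * ‖a‖ ≤ 1 * 1 := by rw [mul_one]; exact le_of_forall_gt_imp_ge_of_dense key
  exact (mul_self_le_mul_self_iff (norm_nonneg _) zero_le_one).2 this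

end Bisection

/-! ### The metric and its completeness on the unit ball. -/

section Metric

theorem isComplete_of_cauchySeq_tendsto {X : Type*} [MetricSpace X] {s : Set X}
    (h : ∀ u : ℕ → X, (∀ n, u n ∈ s) → (∀ ε > 0, ∃ N, ∀ m ≥ N, ∀ n ≥ N, dist (u m) (u n) < ε) →
      ∃ a ∈ s, Tendsto (fun n => dist (u n) a) atTop (𝓝 0)) : IsComplete s := by
  rw [← completeSpace_coe_iff_isComplete]
  refine Metric.complete_of_cauchySeq_tendsto fun u hu => ?_
  obtain ⟨a, ha, hlim⟩ := h (fun n => u n) (fun n => (u n).2) fun ε hε => Metric.cauchySeq_iff.1 hu ε hε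
  exact ⟨⟨a, ha⟩, tendsto_iff_dist_tendsto_zero.2 hlim⟩

variable {M : Type*} [CStarAlgebra M] [PartialOrder M] [StarOrderedRing M] {τ : M → ℂ}

/-- The metric `d_τ` of a faithful quasitrace. -/
@[reducible]
noncomputable def IsQuasitrace.metricSpace (hτ : IsQuasitrace τ) (hf : IsFaithful τ) :
    MetricSpace M where
  dist := d τ
  dist_self x := by
    rw [d, sub_self, hτ.norm₂_zero, Real.zero_rpow (by norm_num)]
  dist_comm x y := by rw [d, d, norm₂_sub_comm]
  dist_triangle x y z := by
    have := hτ.norm₂_add_rpow_le hf (x - y) (y - z)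
    rwa [sub_add_sub_cancel] at this
  eq_of_dist_eq_zero {x y} hxy := by
    have h1 : norm₂ τ (x - y) = 0 :=
      (Real.rpow_eq_zero (norm₂_nonneg _ _) (by norm_num)).1 hxy
    exact sub_eq_zero.1 ((hτ.norm₂_eq_zero hf).1 h1)

end Metric

end Quasitrace

open Filter Topology in
theorem proposition3p10 {M : Type*} [CStarAlgebra M] [PartialOrder M] [StarOrderedRing M]
    (hAW : Quasitrace.IsAWStar M) (hfin : Quasitrace.IsFiniteAlg M)
    (τ : M → ℂ) (hτ : Quasitrace.IsQuasitrace τ) (hfaithful : Quasitrace.IsFaithful τ)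
    (hnormal : Quasitrace.IsNormal τ) :
    ∃ m : MetricSpace M, (∀ x y : M, m.dist x y = Quasitrace.d τ x y) ∧
      @IsComplete M m.toUniformSpace {x : M | ‖x‖ ≤ 1} := by
  refine ⟨hτ.metricSpace hfaithful, fun x y => rfl,
    @Quasitrace.isComplete_of_cauchySeq_tendsto M (hτ.metricSpace hfaithful) _ ?_⟩
  intro u hu hcau
  have hC : Quasitrace.IsCauchy₂ τ u := by
    refine tendsto_order.2 ⟨fun a ha => Eventually.of_forall fun i =>
      ha.trans_le (Quasitrace.norm₂_nonneg _ _), fun a ha => ?_⟩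
    obtain ⟨N, hN⟩ := hcau (a ^ (2 / 3 : ℝ)) (Real.rpow_pos_of_pos ha _)
    filter_upwards [(eventually_ge_atTop N).prod_mk (eventually_ge_atTop N)] with p hp
    exact (Real.rpow_lt_rpow_iff (Quasitrace.norm₂_nonneg _ _) ha.le (by norm_num)).1
      (hN p.1 hp.1 p.2 hp.2)
  obtain ⟨a, ha⟩ := hC.exists_limit hAW hτ hfaithful hnormal hu
  refine ⟨a, ha.norm_limit_le_one hAW hτ hfaithful hu, ?_⟩
  have h1 := Tendsto.rpow_const ha (p := 2 / 3) (Or.inr (by norm_num))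
  rwa [Real.zero_rpow (by norm_num)] at h1
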